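/- **Theorem 1.2 (2D REP with nonzero background).** Let $k>0$ and $c>0$. Consider the two-dimensional restricted Euler–Poisson system along particle paths, $$\frac{d}{dt}M+M^2=\frac k2(\rho-c)\,I_{2\times2},\qquad \frac{d}{dt}\rho+\rho\,\mathrm{tr}\,M=0,$$ for $M=M(\alpha,t)\in\mathbb R^{2\times 2}$ and $\rho=\rho(\alpha,t)\in\mathbb R$, where $\alpha\in\mathbb R^2$ is the particle label (Lagrangian coordinate) and $d/dt$ is the time derivative at fixed $\alpha$, with $C^\infty$ initial data $(M,\rho)(\alpha,0)=(M_0,\rho_0)(\alpha)$, $\rho_0\ge 0$. Put $d_0=\mathrm{tr}\,M_0$ and $\Gamma_0=(\mathrm{tr}\,M_0)^2-4\det M_0$. Then there is a solution that is smooth for all time (that is, $C^\infty$ on $\mathbb R^2\times[0,\infty)$) if and only if $(\rho_0,d_0,\Gamma_0)(\alpha)\in S_1\cup S_2\cup S_3$ for every $\alpha\in\mathbb R^2$, where $S_1,S_2,S_3$ are the following sets of triples $(\rho,d,\Gamma)$ with $\rho\ge0$. - $S_1$: $\Gamma\le 0$ if $\rho>0$, and $\Gamma<0$ if $\rho=0$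 ($d$ is arbitrary in both cases). - $S_2$: $0<\Gamma<\dfrac{k}{2c}\rho^2$, and $$|d|\le g_1(\rho,\Gamma)\ \text{ if } \rho\le\rho^*(\rho,\Gamma),\qquad d=g_1(\rho,\Gamma)\ \text{ if } \rho>\rho^*(\rho,\Gamma),$$ where $$\rho^*(\rho,\Gamma)=\frac{k+\sqrt{k^2-2ck\beta}}{\beta},\quad \beta=\frac{\Gamma}{\rho^2},$$ $$g_1(\rho,\Gamma)=\sqrt{\Gamma-2k\left[c+\sqrt{\rho^2-2ck^{-1}\Gamma}+\rho\ln\left(\frac{\rho-\sqrt{\rho^2-2ck^{-1}\Gamma}}{2c}\right)\right]}.$$ - $S_3$: $\rho>0$, $\Gamma=\dfrac{k}{2c}\rho^2$, $d=g_2(\rho)$, where $$g_2(\rho)=\sqrt{-2ck+\frac{k}{2c}\rho^2+2k\rho\ln\left(\frac{2c}{\rho}\right)}.$$ Here a condition that involves $g_1$ or $g_2$ includes the requirement that the expression under its outer square root is nonnegative. In particular, if $\Gamma_0(\alpha)>\dfrac{k}{2c}\rho_0(\alpha)^2$ for some $\alpha$, the solution breaks down in finite time along the path of that particle: for some $T>0$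 the system has no solution along that path on $[0,T]$. -/

import Mathlib

open scoped ContDiff

/-- The plane of particle labels (Lagrangian coordinates). -/
abbrev Plane : Type := EuclideanSpace ℝ (Fin 2)

/-- Real `2 × 2` matrices. -/
abbrev Mat2 : Type := Matrix (Fin 2) (Fin 2) ℝ

/-- The divergence `d = tr M`. -/
def divergence (A : Mat2) : ℝ := A.trace

/-- The square of the spectral gap, `Γ = (tr M)² - 4 det M = (λ₂ - λ₁)²`. -/
def gapSq (A : Mat2) : ℝ := A.trace ^ 2 - 4 * A.det

/-- The curves `t ↦ M t`, `t ↦ ρ t` solve, on the time interval `I`, the restricted Euler-Poisson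
system along one particle path, where `d/dt` is the derivative along the path:
`dM/dt + M² = (k/2) (ρ - c) I` (entry by entry) and `dρ/dt + ρ tr M = 0`. -/
structure IsREPPath (k c : ℝ) (I : Set ℝ) (M : ℝ → Mat2) (ρ : ℝ → ℝ) : Prop where
  velocity : ∀ t ∈ I, ∀ i j : Fin 2,
    HasDerivWithinAt (fun s => M s i j)
      (((k / 2 * (ρ t - c)) • (1 : Mat2) - M t * M t) i j) I t
  mass : ∀ t ∈ I, HasDerivWithinAt ρ (-(ρ t * (M t).trace)) I t

/-- `(M, ρ)` is a smooth solution on the time interval `I` of the 2D restricted Euler-Poisson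
system with initial data `(M₀, ρ₀)`, in Lagrangian coordinates: `M t α` and `ρ t α` are the values
at time `t` at the particle with label `α`.  Smooth means `C^∞` jointly in time and label. -/
structure IsSmoothREPSolution (k c : ℝ) (M₀ : Plane → Mat2) (ρ₀ : Plane → ℝ) (I : Set ℝ)
    (M : ℝ → Plane → Mat2) (ρ : ℝ → Plane → ℝ) : Prop where
  smooth_velocity : ∀ i j : Fin 2,
    ContDiffOn ℝ ∞ (fun p : ℝ × Plane => M p.1 p.2 i j) (I ×ˢ (Set.univ : Set Plane))
  smooth_density :
    ContDiffOn ℝ ∞ (fun p : ℝ × Plane => ρ p.1 p.2) (I ×ˢ (Set.univ : Set Plane))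
  path : ∀ α : Plane, IsREPPath k c I (fun t => M t α) (fun t => ρ t α)
  initial_velocity : ∀ α : Plane, M 0 α = M₀ α
  initial_density : ∀ α : Plane, ρ 0 α = ρ₀ α

/-- The solution with initial data `(M₀, ρ₀)` remains smooth for all time. -/
def RemainsSmooth (k c : ℝ) (M₀ : Plane → Mat2) (ρ₀ : Plane → ℝ) : Prop :=
  ∃ (M : ℝ → Plane → Mat2) (ρ : ℝ → Plane → ℝ),
    IsSmoothREPSolution k c M₀ ρ₀ (Set.Ici 0) M ρ

/-- Finite-time breakdown along a particle path starting from the state `(A, r)`: for some finite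
`T > 0` there is no solution along the path on `[0, T]`, not even a merely differentiable one. -/
def BreaksDown (k c : ℝ) (A : Mat2) (r : ℝ) : Prop :=
  ∃ T : ℝ, 0 < T ∧ ¬ ∃ (M : ℝ → Mat2) (ρ : ℝ → ℝ),
    IsREPPath k c (Set.Icc 0 T) M ρ ∧ M 0 = A ∧ ρ 0 = r

noncomputable section

/-- The first region, in the variables `(ρ, d, Γ)`. -/
def regionS₁ : Set (ℝ × ℝ × ℝ) :=
  {p | match p with
    | (ρ, _, Γ) => Γ ≤ 0 ∧ (ρ = 0 → Γ < 0)}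

/-- The larger of the two equilibrium densities, `β⁻¹ (k + √(k² - 2 c k β))` with `β = Γ / ρ²`. -/
def rhoStar (k c ρ Γ : ℝ) : ℝ :=
  (k + √(k ^ 2 - 2 * c * k * (Γ / ρ ^ 2))) / (Γ / ρ ^ 2)

/-- The radicand of `g₁`. -/
def g₁Radicand (k c ρ Γ : ℝ) : ℝ :=
  Γ - 2 * k * (c + √(ρ ^ 2 - 2 * c * Γ / k)
    + ρ * Real.log ((ρ - √(ρ ^ 2 - 2 * c * Γ / k)) / (2 * c)))

/-- The threshold `g₁`, meaningful where its radicand is nonnegative. -/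
def g₁ (k c ρ Γ : ℝ) : ℝ := √(g₁Radicand k c ρ Γ)

/-- The second region.  The condition on the radicand says that the real number `g₁` exists. -/
def regionS₂ (k c : ℝ) : Set (ℝ × ℝ × ℝ) :=
  {p | match p with
    | (ρ, d, Γ) => 0 < Γ ∧ Γ < k / (2 * c) * ρ ^ 2 ∧ 0 ≤ g₁Radicand k c ρ Γ ∧
        (ρ ≤ rhoStar k c ρ Γ → |d| ≤ g₁ k c ρ Γ) ∧
        (rhoStar k c ρ Γ < ρ → d = g₁ k c ρ Γ)}

/-- The radicand of `g₂`. -/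
def g₂Radicand (k c ρ : ℝ) : ℝ :=
  -(2 * c * k) + k / (2 * c) * ρ ^ 2 + 2 * k * ρ * Real.log (2 * c / ρ)

/-- The threshold `g₂`, meaningful where its radicand is nonnegative. -/
def g₂ (k c ρ : ℝ) : ℝ := √(g₂Radicand k c ρ)

/-- The third region.  The condition on the radicand says that the real number `g₂` exists. -/
def regionS₃ (k c : ℝ) : Set (ℝ × ℝ × ℝ) :=
  {p | match p with
    | (ρ, d, Γ) => 0 < ρ ∧ Γ = k / (2 * c) * ρ ^ 2 ∧ 0 ≤ g₂Radicand k c ρ ∧ d = g₂ k c ρ}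

end

open Set Filter Topology

/-! ### Autonomous ordinary differential equations: uniqueness, gluing, rescaling. -/

section VectorField

variable {E : Type*} [NormedAddCommGroup E] [NormedSpace ℝ E] {V : E → E} {γ γ' : ℝ → E}

/-! Along a path put `w = exp (∫ tr M)`. The trace-free part of `M` and the density both decay like
`1 / w`, so `ρ w` and `Γ w ^ 2` are conserved. The matrix system thus becomes one scalar equation
for the dilation factor, `w'' = (w' ^ 2 - Γ) / (2 w) + k ρ - k c w` with `w 0 = 1`, `w' 0 = d`,
where `ρ`, `Γ` are now the initial values. A path exists for all time iff this equation has a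
positive solution for all time (`hasGlobalPath_iff`).

The scalar equation conserves `E = w' ^ 2 / w + potential w` (`IsDilation.sq_speed`), so it is a
particle moving in a potential well. The potential tends to `+∞` at infinity, which bounds `w`, and
the only danger is collapse to `0`. Its critical points solve `k c x ^ 2 - k ρ x + Γ / 2 = 0`. In
`S₁` the potential blows up to `+∞` at `0`, and every path survives. For `0 < Γ < k ρ ^ 2 / (2 c)`
there is a hill at `lowerRoot` and a valley at `upperRoot`; `g₁ ^ 2` is the height of the hill above
the starting level, and `ρ ≤ ρ*` says that the start `1` is not to the left of the hill. A start
there survives iff its energy does not exceed the hill. A start to the left survives only if it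
climbs with exactly the energy of the hilltop, which it then approaches forever. `S₃` is the
borderline where hill and valley merge into an inflection point at `ρ / (2 c)`. For larger `Γ` the
potential is strictly increasing without critical points, and every path collapses.

Collapse takes finite time because `√w` decreases at a rate bounded away from zero
(`IsDilation.not_falling`). Necessity rests on `IsDilation.exists_critical_level`, sufficiency on
`exists_isDilation_of_barrier` and `exists_isDilation_of_critical`.

Passing from single paths to a jointly smooth solution is smooth dependence on initial data
(`contDiffOn_uncurry_of_isIntegralCurveOn`), obtained from the implicit function theorem for the
Picard integral equation. Breakdown on a bounded interval follows from global nonexistence, because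
by uniqueness solutions on all `[0, T]` would glue. -/

theorem IsIntegralCurveOn.hasDerivWithinAt_Ici {v : ℝ → E → E} {a b t : ℝ}
    (h : IsIntegralCurveOn γ v (Icc a b)) (ht : t ∈ Ico a b) :
    HasDerivWithinAt γ (v t (γ t)) (Ici t) t :=
  (h t (Ico_subset_Icc_self ht)).mono_of_mem_nhdsWithin (Icc_mem_nhdsGE_of_mem ht)

/-- Uniqueness for autonomous locally Lipschitz vector fields on a compact interval. -/
theorem IsIntegralCurveOn.eqOn_Icc_of_locallyLipschitz (hV : LocallyLipschitz V) {a b : ℝ}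
    (h : IsIntegralCurveOn γ (fun _ => V) (Icc a b))
    (h' : IsIntegralCurveOn γ' (fun _ => V) (Icc a b)) (heq : γ a = γ' a) :
    EqOn γ γ' (Icc a b) := by
  have hK : IsCompact (γ '' Icc a b ∪ γ' '' Icc a b) :=
    (isCompact_Icc.image_of_continuousOn h.continuousOn).union
      (isCompact_Icc.image_of_continuousOn h'.continuousOn)
  obtain ⟨K, hK⟩ :=
    (hV.locallyLipschitzOn (s := γ '' Icc a b ∪ γ' '' Icc a b)
      ).exists_lipschitzOnWith_of_compact hK
  exact ODE_solution_unique_of_mem_Icc_right (v := fun _ => V)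
    (s := fun _ => γ '' Icc a b ∪ γ' '' Icc a b) (fun _ _ => hK)
    h.continuousOn (fun _ ht => h.hasDerivWithinAt_Ici ht)
    (fun t ht => Or.inl ⟨t, Ico_subset_Icc_self ht, rfl⟩)
    h'.continuousOn (fun _ ht => h'.hasDerivWithinAt_Ici ht)
    (fun t ht => Or.inr ⟨t, Ico_subset_Icc_self ht, rfl⟩) heq

/-- Solutions on all compact intervals `[0, T]` glue to a solution on `[0, ∞)`. -/
theorem exists_isIntegralCurveOn_Ici_of_Icc (hV : LocallyLipschitz V) {x : E}
    (h : ∀ T : ℝ, 0 < T → ∃ γ : ℝ → E, γ 0 = x ∧ IsIntegralCurveOn γ (fun _ => V) (Icc 0 T)) :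
    ∃ γ : ℝ → E, γ 0 = x ∧ IsIntegralCurveOn γ (fun _ => V) (Ici 0) := by
  -- The extra `1` makes the solution chosen for `t` live on a neighbourhood of `t` in `[0, ∞)`, so
  -- that the diagonal `t ↦ G t t` can be differentiated there.
  have h1 : ∀ t : ℝ, 0 < |t| + 1 := fun t => by positivity
  choose G hG0 hG using fun t : ℝ => h (|t| + 1) (h1 t)
  have key : ∀ t₀ : ℝ, 0 ≤ t₀ → ∀ t, 0 ≤ t → t < t₀ + 1 → G t t = G t₀ t := by
    intro t₀ ht₀ t ht htt
    refine IsIntegralCurveOn.eqOn_Icc_of_locallyLipschitz hV (a := 0) (b := t) ((hG t).mono ?_)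
      ((hG t₀).mono ?_) ((hG0 t).trans (hG0 t₀).symm) ⟨ht, le_rfl⟩
    · exact Icc_subset_Icc_right (by rw [abs_of_nonneg ht]; linarith)
    · exact Icc_subset_Icc_right (by rw [abs_of_nonneg ht₀]; linarith)
  refine ⟨fun t => G t t, hG0 0, fun t₀ ht₀ => ?_⟩
  have ht₀' : 0 ≤ t₀ := ht₀
  have h2 := hG t₀ t₀ ⟨ht₀, by rw [abs_of_nonneg ht₀']; linarith⟩
  have h3 : HasDerivWithinAt (G t₀) (V (G t₀ t₀)) (Ici 0) t₀ := by
    refine h2.mono_of_mem_nhdsWithin ?_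
    rw [← Ici_inter_Iic]
    exact inter_mem self_mem_nhdsWithin (mem_nhdsWithin_of_mem_nhds
      (Iic_mem_nhds (by rw [abs_of_nonneg ht₀']; linarith)))
  refine h3.congr_of_eventuallyEq ?_ rfl
  filter_upwards [self_mem_nhdsWithin, mem_nhdsWithin_of_mem_nhds
    (Iio_mem_nhds (show t₀ < t₀ + 1 by linarith))] with t ht htt
  exact key t₀ ht₀ t ht htt

/-- Integral curves of an autonomous field can be shifted and slowed down. -/
theorem IsIntegralCurveOn.comp_affine_unitInterval (h : IsIntegralCurveOn γ (fun _ => V) (Ici 0))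
    {t τ : ℝ} (ht : 0 ≤ t) (hτ : 0 ≤ τ) :
    IsIntegralCurveOn (fun s => γ (t + s * τ)) (fun _ x => τ • V x) (Icc 0 1) := by
  intro s hs
  have h1 : HasDerivWithinAt (fun s : ℝ => t + s * τ) τ (Icc 0 1) s := by
    simpa using (((hasDerivAt_id s).mul_const τ).const_add t).hasDerivWithinAt
  exact (h (t + s * τ) (add_nonneg ht (mul_nonneg hs.1 hτ))).scomp s h1
    (fun r hr => add_nonneg ht (mul_nonneg hr.1 hτ))

end VectorField

/-! ### Integration as a bounded operator on continuous functions. -/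

section UnitInterval

open unitInterval

/-- The Volterra operator `u ↦ ∫₀ˢ u` on `C([0, 1], ℝ)`. -/
noncomputable def volterra : C(I, ℝ) →L[ℝ] C(I, ℝ) :=
  LinearMap.mkContinuous
    { toFun := fun u => ⟨fun s => ∫ r in (0 : ℝ)..s, u (projIcc 0 1 zero_le_one r), by
          have h : Continuous fun r : ℝ => u (projIcc 0 1 zero_le_one r) :=
            u.continuous.comp continuous_projIcc
          exact (intervalIntegral.continuous_primitive
            (fun a b => h.intervalIntegrable a b) 0).comp continuous_subtype_val⟩
      map_add' := fun u v => by
        ext s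
        have h : ∀ u : C(I, ℝ), Continuous fun r : ℝ => u (projIcc 0 1 zero_le_one r) :=
          fun u => u.continuous.comp continuous_projIcc
        exact intervalIntegral.integral_add ((h u).intervalIntegrable _ _)
          ((h v).intervalIntegrable _ _)
      map_smul' := fun c u => by
        ext s
        exact intervalIntegral.integral_const_mul c _ }
    1 (fun u => by
      rw [one_mul, ContinuousMap.norm_le _ (norm_nonneg u)]
      intro s
      refine (intervalIntegral.norm_integral_le_of_norm_le_const
        (fun r _ => u.norm_coe_le_norm _)).trans ?_
      rw [sub_zero, abs_of_nonneg s.2.1]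
      exact mul_le_of_le_one_right (norm_nonneg u) s.2.2)

theorem volterra_apply (u : C(I, ℝ)) (s : I) :
    volterra u s = ∫ r in (0 : ℝ)..s, u (projIcc 0 1 zero_le_one r) := rfl

theorem hasDerivWithinAt_volterra (u : C(I, ℝ)) {s : ℝ} (hs : s ∈ Icc (0 : ℝ) 1) :
    HasDerivWithinAt (fun r => volterra u (projIcc 0 1 zero_le_one r))
      (u (projIcc 0 1 zero_le_one s)) (Icc 0 1) s := by
  have h : Continuous fun r : ℝ => u (projIcc 0 1 zero_le_one r) :=
    u.continuous.comp continuous_projIcc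
  refine (h.integral_hasStrictDerivAt 0 s).hasDerivAt.hasDerivWithinAt.congr (fun r hr => ?_) ?_
  · rw [volterra_apply, projIcc_of_mem zero_le_one hr]
  · rw [volterra_apply, projIcc_of_mem zero_le_one hs]

end UnitInterval

/-! ### Smooth dependence on initial data for polynomial vector fields. -/

section PolynomialField

open unitInterval

variable {ι : Type*} [Fintype ι]

/-- The vector field on `ι → ℝ` with polynomial components `P`. -/
noncomputable def polyField (P : ι → MvPolynomial ι ℝ) (x : ι → ℝ) : ι → ℝ :=
  fun i => MvPolynomial.aeval x (P i)

theorem contDiff_polyField (P : ι → MvPolynomial ι ℝ) {n : ℕ∞ω} : ContDiff ℝ n (polyField P) := by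
  rw [contDiff_pi]
  intro i
  refine ContDiff.of_le (n := ω) ?_ le_top
  rw [contDiff_iff_contDiffAt]
  intro x
  exact (AnalyticAt.aeval_mvPolynomial (f := fun x : ι → ℝ => x)
    (fun i => (ContinuousLinearMap.proj (R := ℝ) (φ := fun _ : ι => ℝ) i).analyticAt x)
    (P i)).contDiffAt

/-- The defect in the integral equation of the rescaled initial value problem
`u' = τ • polyField P u`, `u 0 = x`, on `[0, 1]`. -/
noncomputable def picardDefect (P : ι → MvPolynomial ι ℝ)
    (p : (ℝ × (ι → ℝ)) × (ι → C(I, ℝ))) : ι → C(I, ℝ) :=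
  fun i => p.2 i - p.1.2 i • 1 - p.1.1 • volterra (MvPolynomial.aeval p.2 (P i))

/-- Polynomials act analytically on the Banach algebra `C(I, ℝ)`, and `volterra` is linear and
bounded. Since time enters as the parameter `τ`, regularity in time and in the initial value come
together. -/
theorem contDiff_picardDefect (P : ι → MvPolynomial ι ℝ) : ContDiff ℝ ω (picardDefect P) := by
  rw [contDiff_pi]
  intro i
  have h1 : ContDiff ℝ ω
      (fun p : (ℝ × (ι → ℝ)) × (ι → C(I, ℝ)) => MvPolynomial.aeval p.2 (P i)) := by
    rw [contDiff_iff_contDiffAt]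
    intro p
    exact (AnalyticAt.aeval_mvPolynomial
      (f := fun p : (ℝ × (ι → ℝ)) × (ι → C(I, ℝ)) => p.2)
      (fun i => ((ContinuousLinearMap.proj (R := ℝ) (φ := fun _ : ι => C(I, ℝ)) i).comp
        (ContinuousLinearMap.snd ℝ _ _)).analyticAt p) (P i)).contDiffAt
  have h2 := volterra.contDiff.comp h1
  have h3 : ContDiff ℝ ω (fun p : (ℝ × (ι → ℝ)) × (ι → C(I, ℝ)) => p.2 i) := by fun_prop
  have h4 : ContDiff ℝ ω (fun p : (ℝ × (ι → ℝ)) × (ι → C(I, ℝ)) => p.1.2 i) := by fun_prop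
  have h5 : ContDiff ℝ ω (fun p : (ℝ × (ι → ℝ)) × (ι → C(I, ℝ)) => p.1.1) := by fun_prop
  exact (h3.sub (h4.smul contDiff_const)).sub (h5.smul h2)

/-- Analytic local solution operator of the rescaled initial value problem. -/
theorem exists_analytic_local_flow (P : ι → MvPolynomial ι ℝ) (x₀ : ι → ℝ) :
    ∃ U : ℝ × (ι → ℝ) → ι → C(I, ℝ), ∀ᶠ p in 𝓝 ((0 : ℝ), x₀),
      ContDiffAt ℝ ω U p ∧ picardDefect P (p, U p) = 0 := by
  set u₀ : ι → C(I, ℝ) := fun i => x₀ i • 1 with hu₀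
  have hF := (contDiff_picardDefect P).contDiffAt (x := (((0 : ℝ), x₀), u₀))
  -- At `τ = 0` the integral term disappears, so the defect is `u - u₀` and its partial derivative
  -- in `u` is the identity.
  have hd : fderiv ℝ (picardDefect P) ((0, x₀), u₀) ∘L .inr ℝ (ℝ × (ι → ℝ)) (ι → C(I, ℝ))
      = ContinuousLinearMap.id ℝ _ := by
    have h1 := (hF.differentiableAt (by simp)).hasFDerivAt
    have h2 : HasFDerivAt (fun u : ι → C(I, ℝ) => (((0 : ℝ), x₀), u))
        (.inr ℝ (ℝ × (ι → ℝ)) (ι → C(I, ℝ))) u₀ := hasFDerivAt_prodMk_right _ _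
    have h3 := HasFDerivAt.comp u₀ h1 h2
    have h4 : HasFDerivAt (picardDefect P ∘ fun u : ι → C(I, ℝ) => (((0 : ℝ), x₀), u))
        (ContinuousLinearMap.id ℝ _) u₀ := by
      have : (picardDefect P ∘ fun u : ι → C(I, ℝ) => (((0 : ℝ), x₀), u)) = fun u => u - u₀ := by
        funext u i
        simp [picardDefect, hu₀]
      rw [this]
      exact (hasFDerivAt_id u₀).sub_const u₀
    exact h3.unique h4
  have hinv : (fderiv ℝ (picardDefect P) ((0, x₀), u₀) ∘L
      .inr ℝ (ℝ × (ι → ℝ)) (ι → C(I, ℝ))).IsInvertible := by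
    rw [hd]
    exact ⟨ContinuousLinearEquiv.refl ℝ _, rfl⟩
  have h0 : picardDefect P ((0, x₀), u₀) = 0 := by
    funext i
    simp [picardDefect, hu₀]
  refine ⟨hF.implicitFunction (by simp) hinv, ?_⟩
  have h1 := hF.contDiffAt_implicitFunction (by simp) hinv
  have h2 := hF.eventually_apply_implicitFunction (by simp) hinv
  filter_upwards [h1.eventually (by simp), h2] with p hp hp'
  exact ⟨hp, hp'.trans h0⟩

theorem isIntegralCurveOn_of_picardDefect_eq_zero {P : ι → MvPolynomial ι ℝ} {τ : ℝ} {x : ι → ℝ}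
    {u : ι → C(I, ℝ)} (h : picardDefect P ((τ, x), u) = 0) :
    IsIntegralCurveOn (fun s i => u i (projIcc 0 1 zero_le_one s))
      (fun _ y => τ • polyField P y) (Icc 0 1) ∧
    (fun i => u i 0) = x := by
  have hu : ∀ i, u i = x i • 1 + τ • volterra (MvPolynomial.aeval u (P i)) := by
    intro i
    have := congrFun h i
    simp only [picardDefect, Pi.zero_apply, sub_sub, sub_eq_zero] at this
    exact this
  constructor
  · intro s hs
    rw [hasDerivWithinAt_pi]
    intro i
    have h1 := ((hasDerivWithinAt_volterra (MvPolynomial.aeval u (P i)) hs).const_mul τ).const_add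
      (x i)
    -- Evaluation at a point is an algebra homomorphism, so it commutes with polynomials.
    have h2 : (MvPolynomial.aeval u (P i)) (projIcc 0 1 zero_le_one s)
        = MvPolynomial.aeval (fun i => u i (projIcc 0 1 zero_le_one s)) (P i) := by
      exact MvPolynomial.comp_aeval_apply u
        (ContinuousMap.evalAlgHom ℝ ℝ (projIcc 0 1 zero_le_one s)) (P i)
    rw [h2] at h1
    refine h1.congr (fun r _ => ?_) ?_
    · rw [hu i]; simp
    · rw [hu i]; simp
  · funext i
    rw [hu i]
    simp [volterra_apply]

/-- Smooth dependence on parameters: a family of forward solutions of a polynomial system with smooth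
initial data is jointly smooth in time and parameter. -/
theorem contDiffOn_uncurry_of_isIntegralCurveOn {F : Type*} [NormedAddCommGroup F]
    [NormedSpace ℝ F] {P : ι → MvPolynomial ι ℝ} {X : ℝ → F → ι → ℝ}
    (hX : ∀ α, IsIntegralCurveOn (fun t => X t α) (fun _ => polyField P) (Ici 0))
    (h0 : ContDiff ℝ ∞ (X 0)) :
    ContDiffOn ℝ ∞ (fun p : ℝ × F => X p.1 p.2) (Ici 0 ×ˢ univ) := by
  -- near every time, smoothness propagates from slightly earlier times
  have step : ∀ α₀ : F, ∀ t : ℝ, 0 ≤ t → ∃ ε > 0, ∀ t', 0 ≤ t' → t - ε < t' → t' ≤ t →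
      ContDiffAt ℝ ∞ (X t') α₀ → ∀ s, t' ≤ s → s < t + ε →
      ContDiffWithinAt ℝ ∞ (fun p : ℝ × F => X p.1 p.2) (Ici t' ×ˢ univ) (s, α₀) := by
    intro α₀ t ht
    obtain ⟨U, hU⟩ := exists_analytic_local_flow P (X t α₀)
    rw [nhds_prod_eq, eventually_prod_iff] at hU
    obtain ⟨pτ, hpτ, px, hpx, hU⟩ := hU
    obtain ⟨ε₁, hε₁, hτ⟩ := Metric.eventually_nhds_iff.mp hpτ
    have hcont := (hX α₀).continuousOn t ht
    obtain ⟨ε₂, hε₂, hx⟩ := Metric.eventually_nhds_iff.mp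
      (eventually_nhdsWithin_iff.mp (hcont.eventually hpx.eventually_nhds))
    -- `ε₂` keeps `X t' α₀` in the domain of the local flow; the half of `ε₁` is spent once on `t -
    -- t'` and once on the time after `t`.
    refine ⟨min (ε₁ / 2) ε₂, by positivity, fun t' ht' htt' ht't hsm s hs hst => ?_⟩
    have hpx' : ∀ᶠ x in 𝓝 (X t' α₀), px x := by
      refine hx ?_ ht'
      rw [Real.dist_eq, abs_lt]
      constructor <;> linarith [min_le_right (ε₁ / 2) ε₂]
    have hτs : ∀ᶠ r in 𝓝 s, pτ (r - t') := by
      filter_upwards [Ioo_mem_nhds (show s - ε₁ / 2 < s by linarith) (show s < t + ε₁ / 2 by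
        linarith [min_le_left (ε₁ / 2) ε₂])] with r hr
      apply hτ
      rw [Real.dist_eq, sub_zero, abs_lt]
      constructor <;> linarith [min_le_left (ε₁ / 2) ε₂, hr.1, hr.2]
    have hα : ∀ᶠ α in 𝓝 α₀, px (X t' α) := hsm.continuousAt.eventually hpx'
    have heq : ∀ r α, t' ≤ r → pτ (r - t') → px (X t' α) →
        X r α = fun i => U (r - t', X t' α) i 1 := by
      intro r α hr hpr hpα
      obtain ⟨hc, hi⟩ := isIntegralCurveOn_of_picardDefect_eq_zero (hU hpr hpα).2
      have h1 := (hX α).comp_affine_unitInterval ht' (sub_nonneg.mpr hr)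
      have h2 := h1.eqOn_Icc_of_locallyLipschitz
        ((contDiff_polyField P (n := 1)).const_smul (r - t')).locallyLipschitz hc (by
          simpa using hi.symm) (right_mem_Icc.mpr zero_le_one)
      simpa using h2
    have hmain : ContDiffAt ℝ ∞ (fun p : ℝ × F => fun i => U (p.1 - t', X t' p.2) i 1) (s, α₀) := by
      have h1 : ContDiffAt ℝ ∞ U (s - t', X t' α₀) :=
        (hU hτs.self_of_nhds hpx'.self_of_nhds).1.of_le le_top
      have h2 : ContDiffAt ℝ ∞ (fun p : ℝ × F => (p.1 - t', X t' p.2)) (s, α₀) :=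
        (contDiffAt_fst.sub contDiffAt_const).prodMk (hsm.comp (s, α₀) contDiffAt_snd)
      have h3 := ContDiffAt.comp (s, α₀) (g := U) h1 h2
      rw [contDiffAt_pi]
      intro i
      exact (((ContinuousMap.evalCLM ℝ (1 : I)).comp
        (ContinuousLinearMap.proj (R := ℝ) (φ := fun _ : ι => C(I, ℝ)) i)).contDiff.contDiffAt).comp
        (s, α₀) h3
    refine hmain.contDiffWithinAt.congr_of_eventuallyEq ?_
      (heq s α₀ hs hτs.self_of_nhds hα.self_of_nhds)
    have := hτs.prod_nhds hα
    rw [EventuallyEq, eventually_nhdsWithin_iff]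
    filter_upwards [this] with p hp hps
    exact heq p.1 p.2 hps.1 hp.1 hp.2
  -- hence smoothness in the parameter holds at all times
  have slice : ∀ α₀ : F, ∀ t : ℝ, 0 ≤ t → ContDiffAt ℝ ∞ (X t) α₀ := by
    intro α₀
    by_contra! hcon
    set B : Set ℝ := {t | 0 ≤ t ∧ ¬ ContDiffAt ℝ ∞ (X t) α₀} with hB
    have hBne : B.Nonempty := hcon
    have hBb : BddBelow B := ⟨0, fun t ht => ht.1⟩
    have hb : 0 ≤ sInf B := le_csInf hBne fun t ht => ht.1
    obtain ⟨ε, hε, hstep⟩ := step α₀ (sInf B) hb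
    obtain ⟨t', ht', htε, ht'b, hsm⟩ : ∃ t', 0 ≤ t' ∧ sInf B - ε < t' ∧ t' ≤ sInf B ∧
        ContDiffAt ℝ ∞ (X t') α₀ := by
      rcases hb.eq_or_lt with h | h
      · exact ⟨0, le_rfl, by linarith, hb, h0.contDiffAt⟩
      · refine ⟨max 0 (sInf B - ε / 2), le_max_left _ _, ?_, ?_, ?_⟩
        · exact lt_of_lt_of_le (by linarith) (le_max_right _ _)
        · exact max_le hb (by linarith)
        · by_contra hn
          have := csInf_le hBb (show max 0 (sInf B - ε / 2) ∈ B from ⟨le_max_left _ _, hn⟩)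
          have h2 : max 0 (sInf B - ε / 2) < sInf B := max_lt h (by linarith)
          linarith
    obtain ⟨t, htB, ht⟩ := exists_lt_of_csInf_lt hBne (show sInf B < sInf B + ε by linarith)
    have htb := csInf_le hBb htB
    have h1 := hstep t' ht' htε ht'b hsm t (ht'b.trans htb) ht
    have h2 : ContDiffWithinAt ℝ ∞ (fun α : F => (t, α)) univ α₀ :=
      (contDiffAt_const.prodMk contDiffAt_id).contDiffWithinAt
    have h3 := h1.comp α₀ h2 (fun α _ => ⟨ht'b.trans htb, mem_univ _⟩)
    exact htB.2 (contDiffWithinAt_univ.mp h3)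
  rintro ⟨t, α₀⟩ ⟨ht, -⟩
  have ht : 0 ≤ t := ht
  obtain ⟨ε, hε, hstep⟩ := step α₀ t ht
  rcases ht.eq_or_lt with h | h
  · subst h
    exact hstep 0 le_rfl (by linarith) le_rfl h0.contDiffAt 0 le_rfl (by linarith)
  -- Starting strictly before `t` turns `Ici t' ×ˢ univ` into a full neighbourhood of `(t, α₀)`.
  · have h1 : max 0 (t - ε / 2) < t := max_lt h (by linarith)
    have h2 := hstep (max 0 (t - ε / 2)) (le_max_left _ _)
      (lt_of_lt_of_le (by linarith) (le_max_right _ _)) h1.le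
      (slice α₀ _ (le_max_left _ _)) t h1.le (by linarith)
    refine h2.mono_of_mem_nhdsWithin (mem_nhdsWithin_of_mem_nhds ?_)
    exact prod_mem_nhds (Ici_mem_nhds h1) univ_mem

end PolynomialField

/-! ### The restricted Euler-Poisson system as a polynomial vector field. -/

section StateSpace

/-- The state `(A, r)` as a vector indexed by the four matrix entries and the density. -/
def packState (A : Mat2) (r : ℝ) : Option (Fin 2 × Fin 2) → ℝ
  | some ij => A ij.1 ij.2
  | none => r

/-- The velocity part of a state vector. -/
def stateMatrix (x : Option (Fin 2 × Fin 2) → ℝ) : Mat2 := fun i j => x (some (i, j))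

theorem packState_stateMatrix (x : Option (Fin 2 × Fin 2) → ℝ) :
    packState (stateMatrix x) (x none) = x := by
  funext i
  cases i <;> rfl

open MvPolynomial in
/-- The right-hand side of the restricted Euler-Poisson system as a polynomial vector field. -/
noncomputable def repPoly (k c : ℝ) :
    Option (Fin 2 × Fin 2) → MvPolynomial (Option (Fin 2 × Fin 2)) ℝ
  | some ij => C (k / 2 * (if ij.1 = ij.2 then 1 else 0)) * (X none - C c)
      - ∑ l, X (some (ij.1, l)) * X (some (l, ij.2))
  | none => -(X none * ∑ l, X (some (l, l)))

theorem isREPPath_iff {k c : ℝ} {I : Set ℝ} {M : ℝ → Mat2} {ρ : ℝ → ℝ} :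
    IsREPPath k c I M ρ ↔
      IsIntegralCurveOn (fun t => packState (M t) (ρ t)) (fun _ => polyField (repPoly k c)) I := by
  have hv : ∀ t i j, polyField (repPoly k c) (packState (M t) (ρ t)) (some (i, j))
      = ((k / 2 * (ρ t - c)) • (1 : Mat2) - M t * M t) i j := by
    intro t i j
    simp [polyField, repPoly, packState, Matrix.mul_apply, Matrix.one_apply]
  have hm : ∀ t, polyField (repPoly k c) (packState (M t) (ρ t)) none
      = -(ρ t * (M t).trace) := by
    intro t
    simp [polyField, repPoly, packState, Matrix.trace]
  constructor
  · intro h t ht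
    rw [hasDerivWithinAt_pi]
    rintro (_ | ⟨i, j⟩)
    · exact (h.mass t ht).congr_deriv (hm t).symm
    · exact (h.velocity t ht i j).congr_deriv (hv t i j).symm
  · intro h
    refine ⟨fun t ht i j => ?_, fun t ht => ?_⟩
    · rw [← hv]; exact hasDerivWithinAt_pi.mp (h t ht) (some (i, j))
    · rw [← hm]; exact hasDerivWithinAt_pi.mp (h t ht) none

/-- The path starting from the state `(A, r)` exists for all positive times. -/
def HasGlobalPath (k c : ℝ) (A : Mat2) (r : ℝ) : Prop :=
  ∃ (M : ℝ → Mat2) (ρ : ℝ → ℝ), IsREPPath k c (Ici 0) M ρ ∧ M 0 = A ∧ ρ 0 = r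

/-- If there were a solution on every `[0, T]`, uniqueness for the locally Lipschitz field would
glue them into a global one. -/
theorem breaksDown_of_not_hasGlobalPath {k c : ℝ} {A : Mat2} {r : ℝ}
    (h : ¬ HasGlobalPath k c A r) : BreaksDown k c A r := by
  by_contra hb
  have hT : ∀ T : ℝ, 0 < T → ∃ (M : ℝ → Mat2) (ρ : ℝ → ℝ),
      IsREPPath k c (Icc 0 T) M ρ ∧ M 0 = A ∧ ρ 0 = r := by
    intro T hT
    by_contra hn
    exact hb ⟨T, hT, hn⟩
  obtain ⟨γ, hγ0, hγ⟩ := exists_isIntegralCurveOn_Ici_of_Icc (x := packState A r)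
    (contDiff_polyField (repPoly k c) (n := 1)).locallyLipschitz (by
      intro T hT0
      obtain ⟨M, ρ, hp, rfl, rfl⟩ := hT T hT0
      exact ⟨_, rfl, isREPPath_iff.mp hp⟩)
  refine h ⟨fun t => stateMatrix (γ t), fun t => γ t none, ?_, ?_, ?_⟩
  · rw [isREPPath_iff]
    simpa only [packState_stateMatrix] using hγ
  · simp only [hγ0]; rfl
  · simp only [hγ0]; rfl

/-- A smooth solution exists for all time as soon as every single path does. -/
theorem remainsSmooth_iff {k c : ℝ} {M₀ : Plane → Mat2} {ρ₀ : Plane → ℝ}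
    (hM₀ : ∀ i j : Fin 2, ContDiff ℝ ∞ (fun α => M₀ α i j)) (hρ₀ : ContDiff ℝ ∞ ρ₀) :
    RemainsSmooth k c M₀ ρ₀ ↔ ∀ α, HasGlobalPath k c (M₀ α) (ρ₀ α) := by
  constructor
  · rintro ⟨M, ρ, h⟩ α
    exact ⟨_, _, h.path α, h.initial_velocity α, h.initial_density α⟩
  · intro h
    choose M ρ hp hM hρ using h
    have hsm := contDiffOn_uncurry_of_isIntegralCurveOn (P := repPoly k c)
      (X := fun t α => packState (M α t) (ρ α t)) (fun α => isREPPath_iff.mp (hp α)) (by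
        rw [contDiff_pi]
        rintro (_ | ⟨i, j⟩)
        · simpa only [packState, hρ] using hρ₀
        · simpa only [packState, hM] using hM₀ i j)
    rw [contDiffOn_pi] at hsm
    exact ⟨fun t α => M α t, fun t α => ρ α t,
      fun i j => hsm (some (i, j)), hsm none, hp, hM, hρ⟩

end StateSpace

/-! ### Reduction of the matrix system to the scalar dilation factor. -/

section Dilation

/-- `w`, with derivative `v`, is the dilation factor along a path that exists for all positive
times: the density is `ρ / w` and the spectral gap squared is `Γ / w ^ 2`. -/
structure IsDilation (k c ρ Γ : ℝ) (w v : ℝ → ℝ) : Prop where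
  init : w 0 = 1
  pos : ∀ t, 0 ≤ t → 0 < w t
  hasDeriv : ∀ t, 0 ≤ t → HasDerivWithinAt w (v t) (Ici 0) t
  hasDeriv_speed : ∀ t, 0 ≤ t →
    HasDerivWithinAt v ((v t ^ 2 - Γ) / (2 * w t) + k * ρ - k * c * w t) (Ici 0) t

theorem eq_of_hasDerivWithinAt_zero {f : ℝ → ℝ}
    (h : ∀ t, 0 ≤ t → HasDerivWithinAt f 0 (Ici 0) t) {t : ℝ} (ht : 0 ≤ t) : f t = f 0 :=
  constant_of_has_deriv_right_zero (a := 0) (b := t)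
    (fun s hs => (h s hs.1).continuousWithinAt.mono Icc_subset_Ici_self)
    (fun s hs => (h s hs.1).mono (Ici_subset_Ici.mpr hs.1)) t ⟨ht, le_rfl⟩

/-- The factor is `w = exp (∫ d)` with `d = tr M`. The off-diagonal entries and the difference of
the diagonal ones satisfy `y' = -d y`, hence `Γ' = -2 d Γ`; also `ρ' = -d ρ`. So `Γ w ^ 2` and `ρ w`
are constant, and `tr (M ^ 2) = (d ^ 2 + Γ) / 2` closes the equation for `w' = d w`. -/
theorem IsREPPath.exists_isDilation {k c : ℝ} {M : ℝ → Mat2} {ρ : ℝ → ℝ}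
    (h : IsREPPath k c (Ici 0) M ρ) :
    ∃ w v : ℝ → ℝ, IsDilation k c (ρ 0) (gapSq (M 0)) w v ∧ v 0 = (M 0).trace := by
  have hMd : ∀ t, 0 ≤ t → ∀ i j, HasDerivWithinAt (fun s => M s i j)
      ((if i = j then k / 2 * (ρ t - c) else 0) - (M t i 0 * M t 0 j + M t i 1 * M t 1 j))
      (Ici 0) t := by
    intro t ht i j
    refine (h.velocity t ht i j).congr_deriv ?_
    simp [Matrix.mul_apply, Matrix.one_apply, Fin.sum_univ_two]
  have hρd : ∀ t, 0 ≤ t → HasDerivWithinAt ρ (-(ρ t * (M t 0 0 + M t 1 1))) (Ici 0) t := by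
    intro t ht
    refine (h.mass t ht).congr_deriv ?_
    rw [Matrix.trace_fin_two]
  set d : ℝ → ℝ := fun t => M t 0 0 + M t 1 1 with hd
  have hdc : ContinuousOn d (Ici 0) := fun t ht =>
    ((hMd t ht 0 0).add (hMd t ht 1 1)).continuousWithinAt
  -- Nothing is known at negative times; freezing `d` there gives a continuous integrand on the
  -- whole line.
  have hdc' : Continuous fun t => d (max t 0) :=
    hdc.comp_continuous (by fun_prop) (fun t => le_max_right t 0)
  set w : ℝ → ℝ := fun t => Real.exp (∫ s in (0 : ℝ)..t, d (max s 0)) with hw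
  have hwpos : ∀ t, 0 < w t := fun t => Real.exp_pos _
  have hw0 : w 0 = 1 := by simp [hw]
  have hwd : ∀ t, 0 ≤ t → HasDerivWithinAt w (d t * w t) (Ici 0) t := by
    intro t ht
    have h1 := (hdc'.integral_hasStrictDerivAt 0 t).hasDerivAt.exp
    rw [max_eq_left ht, mul_comm] at h1
    exact h1.hasDerivWithinAt
  have hρw : ∀ t, 0 ≤ t → ρ t * w t = ρ 0 := by
    intro t ht
    have := eq_of_hasDerivWithinAt_zero (f := fun t => ρ t * w t) (fun t ht => by
      refine ((hρd t ht).mul (hwd t ht)).congr_deriv ?_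
      simp only [hd]; ring) ht
    simpa [hw0] using this
  set Γ : ℝ → ℝ := fun t => (M t 0 0 - M t 1 1) ^ 2 + 4 * (M t 0 1 * M t 1 0) with hΓ
  have hΓw : ∀ t, 0 ≤ t → Γ t * w t ^ 2 = Γ 0 := by
    intro t ht
    have := eq_of_hasDerivWithinAt_zero (f := fun t => Γ t * w t ^ 2) (fun t ht => by
      refine (((((hMd t ht 0 0).sub (hMd t ht 1 1)).pow 2).add
        (((hMd t ht 0 1).mul (hMd t ht 1 0)).const_mul 4)).mul ((hwd t ht).pow 2)).congr_deriv ?_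
      simp [hd]; ring) ht
    simpa [hw0] using this
  have hgap : gapSq (M 0) = Γ 0 := by
    rw [gapSq, Matrix.trace_fin_two, Matrix.det_fin_two]; ring
  refine ⟨w, fun t => d t * w t, ⟨hw0, fun t _ => hwpos t, hwd, fun t ht => ?_⟩, ?_⟩
  · refine (((hMd t ht 0 0).add (hMd t ht 1 1)).mul (hwd t ht)).congr_deriv ?_
    rw [hgap, ← hΓw t ht, ← hρw t ht]
    have := (hwpos t).ne'
    simp [hd]
    field_simp
    ring
  · simp only [hw0, hd, Matrix.trace_fin_two, mul_one]

/-- The matrix is rebuilt as the trace-free part of `A` divided by `w`, plus `v / (2 w)` times the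
identity. -/
theorem IsDilation.hasGlobalPath {k c r : ℝ} {A : Mat2} {w v : ℝ → ℝ}
    (h : IsDilation k c r (gapSq A) w v) (hv : v 0 = A.trace) : HasGlobalPath k c A r := by
  refine ⟨fun t => !![(A 0 0 - A 1 1) / 2 / w t + v t / (2 * w t), A 0 1 / w t;
      A 1 0 / w t, (A 1 1 - A 0 0) / 2 / w t + v t / (2 * w t)], fun t => r / w t,
    ⟨fun t ht i j => ?_, fun t ht => ?_⟩, ?_, ?_⟩
  · have ht : 0 ≤ t := ht
    have hw := (h.pos t ht).ne'
    have h2w : 2 * w t ≠ 0 := by positivity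
    have hΓ : gapSq A = (A 0 0 - A 1 1) ^ 2 + 4 * (A 0 1 * A 1 0) := by
      rw [gapSq, Matrix.trace_fin_two, Matrix.det_fin_two]; ring
    have hd : ∀ a : ℝ, HasDerivWithinAt (fun s => a / w s) (-(a * v t) / w t ^ 2) (Ici 0) t := by
      intro a
      refine ((hasDerivWithinAt_const t (Ici 0) a).div (h.hasDeriv t ht) hw).congr_deriv ?_
      ring
    have hs := (h.hasDeriv_speed t ht).div ((h.hasDeriv t ht).const_mul 2) h2w
    rw [hΓ] at hs
    fin_cases i <;> fin_cases j
    · refine ((hd ((A 0 0 - A 1 1) / 2)).add hs).congr_deriv ?_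
      simp
      field_simp
      ring
    · refine (hd (A 0 1)).congr_deriv ?_
      simp
      field_simp
      ring
    · refine (hd (A 1 0)).congr_deriv ?_
      simp
      field_simp
      ring
    · refine ((hd ((A 1 1 - A 0 0) / 2)).add hs).congr_deriv ?_
      simp
      field_simp
      ring
  · have hw := (h.pos t ht).ne'
    refine ((hasDerivWithinAt_const t (Ici 0) r).div (h.hasDeriv t ht) hw).congr_deriv ?_
    simp [Matrix.trace_fin_two]
    field_simp
    ring
  · simp only [h.init, hv, Matrix.trace_fin_two]
    ext i j
    fin_cases i <;> fin_cases j <;> simp <;> ring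
  · simp [h.init]

theorem hasGlobalPath_iff {k c r : ℝ} {A : Mat2} :
    HasGlobalPath k c A r ↔
      ∃ w v : ℝ → ℝ, IsDilation k c r (gapSq A) w v ∧ v 0 = divergence A := by
  constructor
  · rintro ⟨M, ρ, h, rfl, rfl⟩
    exact h.exists_isDilation
  · rintro ⟨w, v, h, hv⟩
    exact h.hasGlobalPath hv

end Dilation

/-! ### The potential and its growth at infinity. -/

section Potential

/-- The potential in the energy law `w' ^ 2 / w + potential w = const` of the dilation factor. -/
noncomputable def potential (k c ρ Γ x : ℝ) : ℝ :=
  -Γ / x - 2 * k * ρ * Real.log x + 2 * k * c * x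

variable {k c ρ Γ : ℝ}

theorem hasDerivAt_potential {x : ℝ} (hx : 0 < x) :
    HasDerivAt (potential k c ρ Γ) (2 * (k * c * x ^ 2 - k * ρ * x + Γ / 2) / x ^ 2) x := by
  have h := (((hasDerivAt_const x (-Γ)).div (hasDerivAt_id x) hx.ne').sub
    ((Real.hasDerivAt_log hx.ne').const_mul (2 * k * ρ))).add
      ((hasDerivAt_id x).const_mul (2 * k * c))
  refine h.congr_deriv ?_
  have := hx.ne'
  simp
  field_simp
  ring

theorem continuousOn_potential : ContinuousOn (potential k c ρ Γ) (Ioi 0) :=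
  fun _ hx => (hasDerivAt_potential hx).continuousAt.continuousWithinAt

theorem exists_potential_gt (hk : 0 < k) (hc : 0 < c) (hρ : 0 ≤ ρ) (C : ℝ) :
    ∃ R, 1 ≤ R ∧ ∀ x, R ≤ x → C < potential k c ρ Γ x := by
  -- In `log (a x) ≤ a x - 1` this slope lets the logarithm consume at most half of the linear term
  -- `2 k c x`; the `+ 1` covers `ρ = 0`.
  set a : ℝ := c / (2 * (ρ + 1)) with ha
  have hρ1 : 0 < ρ + 1 := by linarith
  have hapos : 0 < a := by positivity
  have hρa : ρ * a ≤ c / 2 := by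
    rw [ha, mul_div_assoc', div_le_div_iff₀ (by positivity) (by norm_num)]
    nlinarith
  set D : ℝ := C + |Γ| + 2 * k * ρ * (-1 - Real.log a) with hD
  have hkc : 0 < k * c := mul_pos hk hc
  refine ⟨max 1 ((|D| + 1) / (k * c)), le_max_left _ _, fun x hx => ?_⟩
  have hx1 : 1 ≤ x := (le_max_left _ _).trans hx
  have hx0 : 0 < x := by linarith
  have hx2 : |D| + 1 ≤ k * c * x := by
    have := (le_max_right _ _).trans hx
    rw [div_le_iff₀ hkc] at this
    linarith
  have hlog : Real.log x ≤ a * x - 1 - Real.log a := by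
    have := Real.log_le_sub_one_of_pos (mul_pos hapos hx0)
    rw [Real.log_mul hapos.ne' hx0.ne'] at this
    linarith
  have h1 : -|Γ| ≤ -Γ / x := by
    rw [le_div_iff₀ hx0]; nlinarith [le_abs_self Γ, abs_nonneg Γ]
  have h2 : 2 * k * ρ * Real.log x ≤ 2 * k * ρ * (a * x - 1 - Real.log a) :=
    mul_le_mul_of_nonneg_left hlog (by positivity)
  have h3 : 2 * k * (ρ * a) * x ≤ 2 * k * (c / 2) * x := by gcongr
  have h4 := le_abs_self D
  unfold potential
  rw [hD] at h4 hx2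
  nlinarith

end Potential

/-! ### Auxiliary real analysis. -/

section RealAnalysis

/-- A function that is negative at `a` and nonnegative at `b` has a first zero. -/
theorem exists_first_zero {f : ℝ → ℝ} {a b : ℝ} (hab : a ≤ b) (hf : ContinuousOn f (Icc a b))
    (ha : f a < 0) (hb : 0 ≤ f b) : ∃ s ∈ Ioc a b, f s = 0 ∧ ∀ t ∈ Ico a s, f t < 0 := by
  have hcl : IsClosed (Icc a b ∩ f ⁻¹' {0}) :=
    hf.preimage_isClosed_of_isClosed isClosed_Icc isClosed_singleton
  have hne : (Icc a b ∩ f ⁻¹' {0}).Nonempty := by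
    obtain ⟨s, hs, h⟩ := intermediate_value_Icc hab hf ⟨ha.le, hb⟩
    exact ⟨s, hs, h⟩
  have hbd : BddBelow (Icc a b ∩ f ⁻¹' {0}) := ⟨a, fun s hs => hs.1.1⟩
  obtain ⟨hs, hs0⟩ := hcl.csInf_mem hne hbd
  set s := sInf (Icc a b ∩ f ⁻¹' {0})
  have hs0 : f s = 0 := hs0
  have has : a < s := hs.1.lt_of_ne (by rintro h; rw [← h] at hs0; linarith)
  refine ⟨s, ⟨has, hs.2⟩, hs0, fun t ht => ?_⟩
  by_contra! hft
  obtain ⟨r, hr, hr0⟩ := intermediate_value_Icc ht.1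
    (hf.mono (Icc_subset_Icc_right (ht.2.le.trans hs.2))) ⟨ha.le, hft⟩
  have := csInf_le hbd (show r ∈ Icc a b ∩ f ⁻¹' {0} from
    ⟨⟨hr.1, hr.2.trans (ht.2.le.trans hs.2)⟩, hr0⟩)
  linarith [hr.2, ht.2]

theorem HasDerivWithinAt.hasDerivAt_of_pos {f : ℝ → ℝ} {f' t : ℝ}
    (h : HasDerivWithinAt f f' (Ici 0) t) (ht : 0 < t) : HasDerivAt f f' t :=
  h.hasDerivAt (Ici_mem_nhds ht)

/-- If a function and its derivative both converge at infinity, the derivative tends to zero. -/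
theorem eq_zero_of_tendsto_of_tendsto_deriv {f f' : ℝ → ℝ} {a b : ℝ}
    (hf : ∀ t, 0 ≤ t → HasDerivWithinAt f (f' t) (Ici 0) t)
    (ha : Tendsto f atTop (𝓝 a)) (hb : Tendsto f' atTop (𝓝 b)) : b = 0 := by
  have hmvt : ∀ n : ℕ, ∃ ξ ∈ Ioo (n : ℝ) (n + 1), f' ξ = (f (n + 1) - f n) / (n + 1 - n) := by
    intro n
    have hn : (0 : ℝ) ≤ n := n.cast_nonneg
    refine exists_hasDerivAt_eq_slope f f' (by linarith) (fun t ht => ?_) (fun t ht => ?_)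
    · exact (hf t (hn.trans ht.1)).continuousWithinAt.mono
        (fun s hs => hn.trans hs.1)
    · exact (hf t (hn.trans ht.1.le)).hasDerivAt_of_pos (hn.trans_lt ht.1)
  choose ξ hξ hξ' using hmvt
  have h1 : Tendsto ξ atTop atTop :=
    tendsto_atTop_mono (fun n => (hξ n).1.le) tendsto_natCast_atTop_atTop
  have h2 : Tendsto (fun n : ℕ => f (n + 1) - f n) atTop (𝓝 (a - a)) :=
    (ha.comp (tendsto_atTop_add_const_right _ 1 tendsto_natCast_atTop_atTop)).sub
      (ha.comp tendsto_natCast_atTop_atTop)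
  have h3 : Tendsto (fun n : ℕ => f' (ξ n)) atTop (𝓝 (a - a)) := by
    refine h2.congr fun n => ?_
    rw [hξ' n]; simp
  rw [sub_self] at h3
  exact tendsto_nhds_unique (hb.comp h1) h3

end RealAnalysis

/-! ### Energy law and necessary conditions for global paths. -/

namespace IsDilation

variable {k c ρ Γ : ℝ} {w v : ℝ → ℝ}

theorem continuousOn (h : IsDilation k c ρ Γ w v) : ContinuousOn w (Ici 0) :=
  fun t ht => (h.hasDeriv t ht).continuousWithinAt

theorem continuousOn_speed (h : IsDilation k c ρ Γ w v) : ContinuousOn v (Ici 0) :=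
  fun t ht => (h.hasDeriv_speed t ht).continuousWithinAt

/-- The quantity `v ^ 2 / w + potential w` has derivative zero along the path. -/
theorem sq_speed (h : IsDilation k c ρ Γ w v) {t : ℝ} (ht : 0 ≤ t) :
    v t ^ 2 = w t * (v 0 ^ 2 + potential k c ρ Γ 1 - potential k c ρ Γ (w t)) := by
  have key := eq_of_hasDerivWithinAt_zero (f := fun t => v t ^ 2 / w t + potential k c ρ Γ (w t))
    (fun t ht => by
      have hw := (h.pos t ht).ne'
      refine ((((h.hasDeriv_speed t ht).pow 2).div (h.hasDeriv t ht) hw).add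
        ((hasDerivAt_potential (h.pos t ht)).comp_hasDerivWithinAt t
          (h.hasDeriv t ht))).congr_deriv ?_
      simp
      field_simp
      ring) ht
  simp only [h.init, div_one] at key
  have hw := (h.pos t ht).ne'
  field_simp at key
  linarith

theorem energy_nonneg (h : IsDilation k c ρ Γ w v) {t : ℝ} (ht : 0 ≤ t) :
    0 ≤ v 0 ^ 2 + potential k c ρ Γ 1 - potential k c ρ Γ (w t) := by
  have h1 := h.sq_speed ht
  have h2 := sq_nonneg (v t)
  rw [h1] at h2
  exact nonneg_of_mul_nonneg_right h2 (h.pos t ht)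

/-- A path cannot be contracting with no barrier ahead. -/
theorem not_falling (h : IsDilation k c ρ Γ w v) {t₁ δ : ℝ} (ht₁ : 0 ≤ t₁) (hv : v t₁ < 0)
    (hδ : 0 < δ) (hK : ∀ x, 0 < x → x ≤ w t₁ →
      δ ≤ v 0 ^ 2 + potential k c ρ Γ 1 - potential k c ρ Γ x) : False := by
  have hanti : ∀ s, t₁ ≤ s → (∀ t ∈ Ico t₁ s, v t < 0) → w s ≤ w t₁ := by
    intro s hs hneg
    refine antitoneOn_of_deriv_nonpos (convex_Icc t₁ s) (h.continuousOn.mono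
      (fun t ht => ht₁.trans ht.1)) (fun t ht => ?_) (fun t ht => ?_)
      (left_mem_Icc.mpr hs) (right_mem_Icc.mpr hs) hs
    all_goals
      rw [interior_Icc] at ht
      have h1 := (h.hasDeriv t (ht₁.trans ht.1.le)).hasDerivAt_of_pos (ht₁.trans_lt ht.1)
    · exact h1.differentiableAt.differentiableWithinAt
    · rw [h1.deriv]; exact (hneg t ⟨ht.1.le, ht.2⟩).le
  -- At a first zero of the speed the energy law would read `0 = w * (E - potential w)`, with the
  -- second factor still at least `δ`.
  have hneg : ∀ t, t₁ ≤ t → v t < 0 := by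
    intro t ht
    by_contra! hvt
    obtain ⟨s, hs, hs0, hsneg⟩ := exists_first_zero ht
      (h.continuousOn_speed.mono (fun r hr => ht₁.trans hr.1)) hv hvt
    have hs' : 0 ≤ s := ht₁.trans hs.1.le
    have h1 := hK (w s) (h.pos s hs') (hanti s hs.1.le hsneg)
    have h2 := h.sq_speed hs'
    have h3 := mul_pos (h.pos s hs') (hδ.trans_le h1)
    rw [← h2, hs0] at h3
    simp at h3
  -- In the variable `√w` the energy law is `|(√w)'| = √(E - potential w) / 2`, so the rate of fall
  -- is at least `√δ / 2`.
  have hspeed : ∀ t, t₁ ≤ t → v t / (2 * √(w t)) ≤ -(√δ / 2) := by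
    intro t ht
    have ht' : 0 ≤ t := ht₁.trans ht
    have hw := h.pos t ht'
    have h1 := hK (w t) hw (hanti t ht (fun r hr => hneg r hr.1))
    have h2 := h.sq_speed ht'
    have h3 : √(w t) * √δ ≤ -v t := by
      rw [← Real.sqrt_mul hw.le]
      refine Real.sqrt_le_iff.mpr ⟨by linarith [hneg t ht], ?_⟩
      rw [neg_sq, h2]
      gcongr
    have h4 := Real.sqrt_pos.mpr hw
    rw [div_le_iff₀ (by positivity)]
    linarith
  have hqd : ∀ t, t₁ ≤ t → HasDerivWithinAt (fun s => √(w s)) (v t / (2 * √(w t))) (Ici 0) t :=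
    fun t ht => (h.hasDeriv t (ht₁.trans ht)).sqrt (h.pos t (ht₁.trans ht)).ne'
  have hbound : ∀ t, t₁ ≤ t → √(w t) - √(w t₁) ≤ -(√δ / 2) * (t - t₁) := by
    intro t ht
    refine (convex_Icc t₁ t).image_sub_le_mul_sub_of_deriv_le (f := fun s => √(w s))
      (fun s hs => ?_) (fun s hs => ?_) (fun s hs => ?_) t₁
      (left_mem_Icc.mpr ht) t (right_mem_Icc.mpr ht) ht
    · exact (hqd s hs.1).continuousWithinAt.mono (fun r hr => ht₁.trans hr.1)
    all_goals
      rw [interior_Icc] at hs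
      have h1 := (hqd s hs.1.le).hasDerivAt_of_pos (ht₁.trans_lt hs.1)
    · exact h1.differentiableAt.differentiableWithinAt
    · rw [h1.deriv]; exact hspeed s hs.1.le
  have hδ' := Real.sqrt_pos.mpr hδ
  have hq₁ := Real.sqrt_nonneg (w t₁)
  -- At this time the linear bound puts `√w` at or below `-1`.
  have h1 := hbound (t₁ + (√(w t₁) + 1) / (√δ / 2)) (by
    have : 0 ≤ (√(w t₁) + 1) / (√δ / 2) := by positivity
    linarith)
  have h2 := Real.sqrt_nonneg (w (t₁ + (√(w t₁) + 1) / (√δ / 2)))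
  rw [add_sub_cancel_left, neg_mul, mul_div_cancel₀ _ (by positivity)] at h1
  linarith

/-- A path that keeps expanding converges to a critical level of the potential. -/
theorem exists_limit_of_speed_nonneg (h : IsDilation k c ρ Γ w v) (hk : 0 < k) (hc : 0 < c)
    (hρ : 0 ≤ ρ) (hv : ∀ t, 0 ≤ t → 0 ≤ v t) :
    ∃ W, 1 ≤ W ∧ potential k c ρ Γ W = v 0 ^ 2 + potential k c ρ Γ 1 ∧
      k * c * W ^ 2 - k * ρ * W + Γ / 2 = 0 ∧
      ∀ x ∈ Ico 1 W, potential k c ρ Γ x ≤ v 0 ^ 2 + potential k c ρ Γ 1 := by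
  have hmono : MonotoneOn w (Ici 0) := by
    refine monotoneOn_of_deriv_nonneg (convex_Ici 0) h.continuousOn (fun t ht => ?_) fun t ht => ?_
    all_goals
      rw [interior_Ici] at ht
      have ht : 0 < t := ht
      have h1 := (h.hasDeriv t ht.le).hasDerivAt_of_pos ht
    · exact h1.differentiableAt.differentiableWithinAt
    · rw [h1.deriv]; exact hv t ht.le
  have hmono' : Monotone fun t => w (max t 0) := fun s t hst =>
    hmono (le_max_right s 0) (le_max_right t 0) (max_le_max_right 0 hst)
  obtain ⟨R, -, hR⟩ := exists_potential_gt (Γ := Γ) hk hc hρ (v 0 ^ 2 + potential k c ρ Γ 1)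
  -- Beyond `R` the potential exceeds the energy, so those levels cannot be reached.
  have hbdd : BddAbove (range fun t => w (max t 0)) := by
    refine ⟨R, ?_⟩
    rintro _ ⟨t, rfl⟩
    by_contra! hlt
    have h1 := h.energy_nonneg (le_max_right t 0)
    have h2 := hR _ hlt.le
    linarith
  set W := ⨆ t, w (max t 0) with hW
  have hlim' : Tendsto (fun t => w (max t 0)) atTop (𝓝 W) := tendsto_atTop_ciSup hmono' hbdd
  have hlim : Tendsto w atTop (𝓝 W) := by
    refine hlim'.congr' ?_
    filter_upwards [eventually_ge_atTop 0] with t ht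
    rw [max_eq_left ht]
  have hW1 : 1 ≤ W := by
    have := le_ciSup hbdd 0
    simpa [h.init] using this
  have hW0 : 0 < W := by linarith
  set E := v 0 ^ 2 + potential k c ρ Γ 1 with hE
  have hvlim : Tendsto v atTop (𝓝 √(W * (E - potential k c ρ Γ W))) := by
    have h1 : Tendsto (fun t => √(w t * (E - potential k c ρ Γ (w t)))) atTop
        (𝓝 √(W * (E - potential k c ρ Γ W))) :=
      (hlim.mul (tendsto_const_nhds.sub
        ((hasDerivAt_potential hW0).continuousAt.tendsto.comp hlim))).sqrt
    refine h1.congr' ?_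
    filter_upwards [eventually_ge_atTop 0] with t ht
    rw [← h.sq_speed ht, Real.sqrt_sq (hv t ht)]
  have hK0 := eq_zero_of_tendsto_of_tendsto_deriv h.hasDeriv hlim hvlim
  rw [hK0] at hvlim
  have hKge : 0 ≤ E - potential k c ρ Γ W := by
    refine ge_of_tendsto (tendsto_const_nhds.sub
      ((hasDerivAt_potential hW0).continuousAt.tendsto.comp hlim)) ?_
    filter_upwards [eventually_ge_atTop 0] with t ht
    exact h.energy_nonneg ht
  have hK : E - potential k c ρ Γ W = 0 := by
    rw [Real.sqrt_eq_zero (by positivity)] at hK0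
    exact (mul_eq_zero.mp hK0).resolve_left hW0.ne'
  -- Now `v → 0` and `v'` converges, so the limit of the right-hand side of the equation vanishes:
  -- `W` is critical.
  have hD := eq_zero_of_tendsto_of_tendsto_deriv h.hasDeriv_speed hvlim
    ((((hvlim.pow 2).sub_const Γ).div (hlim.const_mul 2) (by positivity)).add_const (k * ρ)
      |>.sub (hlim.const_mul (k * c)))
  refine ⟨W, hW1, by linarith, ?_, fun x hx => ?_⟩
  · field_simp at hD
    linarith
  · obtain ⟨t, hxt, ht⟩ := ((hlim.eventually_const_lt hx.2).and (eventually_ge_atTop 0)).exists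
    obtain ⟨s, hs, rfl⟩ := intermediate_value_Icc ht
      (h.continuousOn.mono Icc_subset_Ici_self) ⟨h.init.trans_le hx.1, hxt.le⟩
    linarith [h.energy_nonneg hs.1]

/-- The potential is singular at `0`, but `x * (E - potential x)` extends continuously to `[0, b]`
with value `Γ > 0` at `0`, so it has a positive minimum. For `Γ = ρ = 0` the potential is linear and
increasing. -/
theorem exists_energy_lower_bound (hΓρ : 0 < Γ ∨ Γ = 0 ∧ ρ = 0) (hk : 0 < k) (hc : 0 < c) {E b : ℝ}
    (hb : 0 < b) (hK : ∀ x, 0 < x → x ≤ b → potential k c ρ Γ x < E) :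
    ∃ δ > 0, ∀ x, 0 < x → x ≤ b → δ ≤ E - potential k c ρ Γ x := by
  rcases hΓρ with hΓ | ⟨rfl, rfl⟩
  · set F : ℝ → ℝ := fun x => x * E + Γ + 2 * k * ρ * (x * Real.log x) - 2 * k * c * x ^ 2 with hF
    have hFc : Continuous F := by
      have := Real.continuous_mul_log
      fun_prop
    have hFK : ∀ x, 0 < x → F x = x * (E - potential k c ρ Γ x) := by
      intro x hx
      simp only [hF, potential]
      field_simp
      ring
    obtain ⟨x₀, hx₀, hmin⟩ := isCompact_Icc.exists_isMinOn (nonempty_Icc.mpr hb.le)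
      hFc.continuousOn
    have hpos : 0 < F x₀ := by
      rcases hx₀.1.eq_or_lt with h | h
      · rw [← h]; simpa [hF] using hΓ
      · rw [hFK x₀ h]; exact mul_pos h (sub_pos.mpr (hK x₀ h hx₀.2))
    refine ⟨F x₀ / b, by positivity, fun x hx hxb => ?_⟩
    have h1 : F x₀ ≤ F x := hmin ⟨hx.le, hxb⟩
    rw [hFK x hx] at h1
    rw [div_le_iff₀ hb]
    nlinarith [hK x hx hxb]
  · refine ⟨E - potential k c 0 0 b, sub_pos.mpr (hK b hb le_rfl), fun x hx hxb => ?_⟩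
    simp only [potential, neg_zero, zero_div, mul_zero, zero_mul, sub_zero, zero_add]
    have : 2 * k * c * x ≤ 2 * k * c * b := by gcongr
    linarith

/-- Without a barrier below, a path that exists for all times must be expanding and be headed
for an unstable equilibrium of the same energy. -/
theorem exists_critical_level (h : IsDilation k c ρ Γ w v) (hk : 0 < k) (hc : 0 < c)
    (hρ : 0 ≤ ρ) (hΓρ : 0 < Γ ∨ Γ = 0 ∧ ρ = 0)
    (hK : ∀ x ∈ Ioo 0 1, potential k c ρ Γ x < v 0 ^ 2 + potential k c ρ Γ 1) :
    0 ≤ v 0 ∧ ∃ W, 1 ≤ W ∧ potential k c ρ Γ W = v 0 ^ 2 + potential k c ρ Γ 1 ∧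
      k * c * W ^ 2 - k * ρ * W + Γ / 2 = 0 ∧
      ∀ x ∈ Ioo 0 W, potential k c ρ Γ x ≤ v 0 ^ 2 + potential k c ρ Γ 1 := by
  set E := v 0 ^ 2 + potential k c ρ Γ 1 with hE
  have hfall : ∀ t, 0 ≤ t → v t < 0 →
      ∃ x, 0 < x ∧ x ≤ w t ∧ E ≤ potential k c ρ Γ x := by
    intro t ht hvt
    by_contra! hcon
    obtain ⟨δ, hδ, hδK⟩ := exists_energy_lower_bound hΓρ hk hc (h.pos t ht) hcon
    exact h.not_falling ht hvt hδ hδK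
  have hv0 : 0 ≤ v 0 := by
    by_contra! hneg
    obtain ⟨x, hx, hx1, hxE⟩ := hfall 0 le_rfl hneg
    rw [h.init] at hx1
    rcases hx1.eq_or_lt with rfl | hlt
    · nlinarith
    · linarith [hK x ⟨hx, hlt⟩]
  refine ⟨hv0, ?_⟩
  by_cases hv : ∀ t, 0 ≤ t → 0 ≤ v t
  · obtain ⟨W, hW1, hWE, hWc, hWle⟩ := h.exists_limit_of_speed_nonneg hk hc hρ hv
    refine ⟨W, hW1, hWE, hWc, fun x hx => ?_⟩
    rcases lt_or_ge x 1 with hx1 | hx1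
    · exact (hK x ⟨hx.1, hx1⟩).le
    · exact hWle x ⟨hx1, hx.2⟩
  · push Not at hv
    obtain ⟨t, ht, hvt⟩ := hv
    -- A level between `1` and `w t` was visited before time `t`, so its potential is at most `E`;
    -- the levels below `1` are covered by `hK`. The level at height `E` found next is therefore an
    -- interior maximum, hence critical.
    have hle : ∀ x ∈ Ioc 0 (w t), potential k c ρ Γ x ≤ E := by
      intro x hx
      rcases lt_or_ge x 1 with hx1 | hx1
      · exact (hK x ⟨hx.1, hx1⟩).le
      · obtain ⟨s, hs, rfl⟩ := intermediate_value_Icc ht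
          (h.continuousOn.mono Icc_subset_Ici_self) ⟨h.init.trans_le hx1, hx.2⟩
        linarith [h.energy_nonneg hs.1]
    obtain ⟨W, hW0, hWt, hWE⟩ := hfall t ht hvt
    have hWE' : potential k c ρ Γ W = E := le_antisymm (hle W ⟨hW0, hWt⟩) hWE
    have hW1 : 1 ≤ W := by
      by_contra! hlt
      linarith [hK W ⟨hW0, hlt⟩]
    have hWlt : W < w t := by
      refine hWt.lt_of_ne ?_
      rintro rfl
      have h1 := h.sq_speed ht
      rw [hWE', sub_self, mul_zero] at h1
      nlinarith
    have hmax : IsLocalMax (potential k c ρ Γ) W := by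
      filter_upwards [Ioo_mem_nhds hW0 hWlt] with x hx
      rw [hWE']
      exact hle x ⟨hx.1, hx.2.le⟩
    have hcrit := hmax.hasDerivAt_eq_zero (hasDerivAt_potential hW0)
    refine ⟨W, hW1, hWE', ?_, fun x hx => hle x ⟨hx.1, hx.2.le.trans hWt⟩⟩
    have := hW0.ne'
    field_simp at hcrit
    linarith

end IsDilation

/-! ### Global solutions of Newton's equation. -/

section Newton

/-- Newton's equation with a bounded Lipschitz force has solutions for all positive times. -/
theorem exists_newton_solution {f : ℝ → ℝ} {L : NNReal} {A : ℝ} (hL : LipschitzWith L f)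
    (hA : ∀ x, |f x| ≤ A) (a b : ℝ) :
    ∃ w v : ℝ → ℝ, w 0 = a ∧ v 0 = b ∧ (∀ t, 0 ≤ t → HasDerivWithinAt w (v t) (Ici 0) t) ∧
      ∀ t, 0 ≤ t → HasDerivWithinAt v (f (w t)) (Ici 0) t := by
  have hA0 : 0 ≤ A := (abs_nonneg _).trans (hA 0)
  have hV : LocallyLipschitz fun p : ℝ × ℝ => (p.2, f p.1) :=
    (LipschitzWith.prod_snd.prodMk (hL.comp LipschitzWith.prod_fst)).locallyLipschitz
  obtain ⟨γ, hγ0, hγ⟩ := exists_isIntegralCurveOn_Ici_of_Icc (x := (a, b)) hV (by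
    intro T hT
    -- cut off the velocity beyond what can be reached before time `T`
    set B : ℝ := |b| + A * T with hB
    have hB0 : 0 ≤ B := by positivity
    have hBB : -B ≤ B := by linarith
    set cl : ℝ → ℝ := fun x => projIcc (-B) B hBB x with hcl
    have hclL : LipschitzWith 1 cl := (LipschitzWith.projIcc hBB)
    have hclB : ∀ x, |cl x| ≤ B := fun x => abs_le.mpr (projIcc (-B) B hBB x).2
    have hV' : LipschitzWith (max (1 * 1) (L * 1)) fun p : ℝ × ℝ => (cl p.2, f p.1) :=
      (hclL.comp LipschitzWith.prod_snd).prodMk (hL.comp LipschitzWith.prod_fst)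
    have hM0 : 0 ≤ max B A := hB0.trans (le_max_left _ _)
    -- The truncated field is bounded everywhere by `max B A`, so a ball of radius `max B A * T`
    -- allows Picard-Lindelöf on all of `[0, T]`.
    have hpl : IsPicardLindelof (fun _ : ℝ => fun p : ℝ × ℝ => (cl p.2, f p.1))
        (⟨0, le_rfl, hT.le⟩ : Icc (0 : ℝ) T) (a, b) (⟨max B A * T, by positivity⟩) 0
        ⟨max B A, hM0⟩ (max (1 * 1) (L * 1)) :=
      { lipschitzOnWith := fun _ _ => hV'.lipschitzOnWith
        continuousOn := fun _ _ => continuousOn_const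
        norm_le := fun _ _ p _ => by
          rw [Prod.norm_def]
          exact max_le_max (hclB _) (hA _)
        mul_max_le := by
          simp [max_eq_left hT.le]
          rfl }
    obtain ⟨γ, hγ0, hγ⟩ := hpl.exists_eq_forall_mem_Icc_hasDerivWithinAt₀
    -- The force is at most `A`, so the speed stays below `|b| + A * T` and the truncation is never
    -- active.
    have hv : ∀ t ∈ Icc 0 T, |(γ t).2| ≤ B := by
      intro t ht
      have h1 := (convex_Icc (0 : ℝ) T).norm_image_sub_le_of_norm_hasDerivWithin_le
        (f := fun t => (γ t).2) (f' := fun t => f (γ t).1) (C := A) (fun s hs => (hγ s hs).snd)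
        (fun s _ => hA _) (left_mem_Icc.mpr hT.le) ht
      simp only [hγ0, Real.norm_eq_abs, sub_zero, abs_of_nonneg ht.1] at h1
      have h2 : A * t ≤ A * T := mul_le_mul_of_nonneg_left ht.2 hA0
      have h3 := abs_sub_abs_le_abs_sub (γ t).2 b
      linarith
    refine ⟨γ, hγ0, fun t ht => (hγ t ht).congr_deriv ?_⟩
    have : cl (γ t).2 = (γ t).2 := by
      rw [hcl]
      simp only
      rw [projIcc_of_mem hBB (abs_le.mp (hv t ht))]
    simp only [this])
  exact ⟨fun t => (γ t).1, fun t => (γ t).2, by simp [hγ0], by simp [hγ0],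
    fun t ht => (hγ t ht).fst, fun t ht => (hγ t ht).snd⟩

/-- Newton's equation on `[m, R]`, with the force continued as a constant outside. -/
theorem exists_clamped_newton_solution {f Φ : ℝ → ℝ} {m R a b : ℝ} (hmR : m ≤ R)
    (hf : LocallyLipschitzOn (Icc m R) f)
    (hΦ : ∀ x ∈ Icc m R, HasDerivAt Φ (2 * f x) x) (ha : a ∈ Icc m R) :
    ∃ w v : ℝ → ℝ, w 0 = a ∧ v 0 = b ∧ (∀ t, 0 ≤ t → HasDerivWithinAt w (v t) (Ici 0) t) ∧
      ContinuousOn v (Ici 0) ∧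
      (∀ t, 0 ≤ t → w t ∈ Icc m R → HasDerivWithinAt v (f (w t)) (Ici 0) t) ∧
      (∀ t, 0 ≤ t → w t ∈ Icc m R → v t ^ 2 = b ^ 2 + Φ (w t) - Φ a) ∧
      ∀ s, 0 ≤ s → w s ∈ Icc m R → v s = 0 → f (w s) = 0 → ∀ t, s ≤ t → w t = w s := by
  obtain ⟨L, hL⟩ := hf.exists_lipschitzOnWith_of_compact isCompact_Icc
  set F : ℝ → ℝ := fun x => f (projIcc m R hmR x) with hF
  have hFL : LipschitzWith L F := by
    have h1 : LipschitzWith L ((Icc m R).domRestrict f) := lipschitzOnWith_iff_restrict.mp hL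
    simpa using! h1.comp (LipschitzWith.projIcc hmR)
  have hFf : ∀ x ∈ Icc m R, F x = f x := by
    intro x hx
    rw [hF]
    simp only
    rw [projIcc_of_mem hmR hx]
  obtain ⟨A, hA⟩ := isCompact_Icc.exists_bound_of_continuousOn hL.continuousOn
  have hFA : ∀ x, |F x| ≤ A := fun x => hA _ (projIcc m R hmR x).2
  obtain ⟨w, v, hw0, hv0, hw, hv⟩ := exists_newton_solution hFL hFA a b
  refine ⟨w, v, hw0, hv0, hw, fun t ht => (hv t ht).continuousWithinAt, fun t ht hwt => ?_,
    fun t ht hwt => ?_, ?_⟩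
  · rw [← hFf _ hwt]; exact hv t ht
  -- Energy is conserved for the extended force at all times, so the law also holds at `t` if the
  -- path has left `[m, R]` in between.
  · set Ψ : ℝ → ℝ := fun x => ∫ y in a..x, 2 * F y with hΨ
    have hFc : Continuous fun y => 2 * F y := continuous_const.mul hFL.continuous
    have h1 := eq_of_hasDerivWithinAt_zero (f := fun t => v t ^ 2 - Ψ (w t)) (fun t ht => by
      refine (((hv t ht).pow 2).sub
        ((hFc.integral_hasStrictDerivAt a (w t)).hasDerivAt.comp_hasDerivWithinAt t
          (hw t ht))).congr_deriv ?_
      simp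
      ring) ht
    have h2 : Ψ (w t) = Φ (w t) - Φ a := by
      refine intervalIntegral.integral_eq_sub_of_hasDerivAt (fun x hx => ?_)
        (hFc.intervalIntegrable _ _)
      have hx' := (ordConnected_Icc.uIcc_subset ha hwt) hx
      rw [hFf x hx']
      exact hΦ x hx'
    have h3 : Ψ (w 0) = 0 := by rw [hΨ]; simp [hw0]
    rw [h2, h3, hv0] at h1
    linarith
  · intro s hs hws hvs hfs t hst
    have hV : LocallyLipschitz fun p : ℝ × ℝ => (p.2, F p.1) :=
      (LipschitzWith.prod_snd.prodMk (hFL.comp LipschitzWith.prod_fst)).locallyLipschitz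
    have h1 : IsIntegralCurveOn (fun t => (w t, v t)) (fun _ p => (p.2, F p.1)) (Icc s t) :=
      fun r hr => ((hw r (hs.trans hr.1)).prodMk (hv r (hs.trans hr.1))).mono
        (fun q hq => hs.trans hq.1)
    have h2 : IsIntegralCurveOn (fun _ => (w s, (0 : ℝ))) (fun _ p => (p.2, F p.1))
        (Icc s t) := by
      intro r _
      refine (hasDerivWithinAt_const _ _ _).congr_deriv ?_
      simp only [hFf _ hws, hfs]
      rfl
    have h3 := h1.eqOn_Icc_of_locallyLipschitz hV h2 (by simp [hvs]) (right_mem_Icc.mpr hst)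
    exact congrArg Prod.fst h3

end Newton

/-! ### Construction of global dilation factors. -/

section Existence

variable {k c ρ Γ d : ℝ}

/-- The right-hand side of the energy law `v ^ 2 = energyFn w`, for the energy `E`. -/
noncomputable def energyFn (k c ρ Γ E x : ℝ) : ℝ :=
  x * E + Γ + 2 * k * ρ * (x * Real.log x) - 2 * k * c * x ^ 2

/-- The force, half the derivative of `energyFn`. -/
noncomputable def forceFn (k c ρ E x : ℝ) : ℝ :=
  E / 2 + k * ρ * (Real.log x + 1) - 2 * k * c * x

theorem energyFn_eq {E x : ℝ} (hx : 0 < x) :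
    energyFn k c ρ Γ E x = x * (E - potential k c ρ Γ x) := by
  simp only [energyFn, potential]
  field_simp
  ring

theorem hasDerivAt_energyFn {E x : ℝ} (hx : 0 < x) :
    HasDerivAt (energyFn k c ρ Γ E) (2 * forceFn k c ρ E x) x := by
  have h := (((hasDerivAt_id x).mul_const E).add_const Γ).add
    ((Real.hasDerivAt_mul_log hx.ne').const_mul (2 * k * ρ)) |>.sub
      (((hasDerivAt_id x).pow 2).const_mul (2 * k * c))
  refine h.congr_deriv ?_
  simp [forceFn]
  ring

/-- Eliminating `v ^ 2` through the energy law makes the force independent of the velocity. This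
identity recovers the original equation once the energy law is known for the constructed path. -/
theorem forceFn_eq {E x : ℝ} (hx : 0 < x) :
    forceFn k c ρ E x = (energyFn k c ρ Γ E x - Γ) / (2 * x) + k * ρ - k * c * x := by
  simp only [energyFn, forceFn]
  field_simp
  ring

theorem locallyLipschitzOn_forceFn {E m R : ℝ} (hm : 0 < m) :
    LocallyLipschitzOn (Icc m R) (forceFn k c ρ E) := by
  intro x hx
  have hx0 : x ≠ 0 := (hm.trans_le hx.1).ne'
  have h : ContDiffAt ℝ 1 (forceFn k c ρ E) x := by
    unfold forceFn
    fun_prop (disch := assumption)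
  obtain ⟨K, t, ht, hK⟩ := h.exists_lipschitzOnWith
  exact ⟨K, t, mem_nhdsWithin_of_mem_nhds ht, hK⟩

theorem forceFn_eq_zero {E x : ℝ} (hx : 0 < x) (hE : potential k c ρ Γ x = E)
    (hcrit : k * c * x ^ 2 - k * ρ * x + Γ / 2 = 0) : forceFn k c ρ E x = 0 := by
  rw [forceFn_eq (Γ := Γ) hx, energyFn_eq hx, hE]
  field_simp
  linarith

/-- A barrier of the potential below the starting point, or at it, keeps the path alive. -/
theorem exists_isDilation_of_barrier {m : ℝ} (hm : 0 < m) (hm1 : m ≤ 1) {R : ℝ} (hR1 : 1 ≤ R)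
    (hR : d ^ 2 + potential k c ρ Γ 1 < potential k c ρ Γ R)
    (hbar : d ^ 2 + potential k c ρ Γ 1 < potential k c ρ Γ m ∨
      potential k c ρ Γ m = d ^ 2 + potential k c ρ Γ 1 ∧
        k * c * m ^ 2 - k * ρ * m + Γ / 2 = 0) :
    ∃ w v : ℝ → ℝ, IsDilation k c ρ Γ w v ∧ v 0 = d := by
  set E := d ^ 2 + potential k c ρ Γ 1 with hE
  obtain ⟨w, v, hw0, hv0, hw, -, hv, hen, heq⟩ := exists_clamped_newton_solution
    (Φ := energyFn k c ρ Γ E) (a := 1) (b := d) (hm1.trans hR1) (locallyLipschitzOn_forceFn hm)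
    (fun x hx => hasDerivAt_energyFn (hm.trans_le hx.1)) ⟨hm1, hR1⟩
  have hen' : ∀ t, 0 ≤ t → w t ∈ Icc m R → v t ^ 2 = w t * (E - potential k c ρ Γ (w t)) := by
    intro t ht hwt
    rw [hen t ht hwt, energyFn_eq (hm.trans_le hwt.1), energyFn_eq one_pos, hE]
    ring
  have hcont : ContinuousOn w (Ici 0) := fun t ht => (hw t ht).continuousWithinAt
  have hup : ∀ t, 0 ≤ t → w t ≤ R := by
    intro t ht
    by_contra! hlt
    obtain ⟨s, hs, hsR⟩ := intermediate_value_Icc ht (hcont.mono Icc_subset_Ici_self)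
      ⟨hw0.trans_le hR1, hlt.le⟩
    have h1 := hen' s hs.1 ⟨by rw [hsR]; exact hm1.trans hR1, hsR.le⟩
    rw [hsR] at h1
    nlinarith [sq_nonneg (v s)]
  have hlow : ∀ t, 0 ≤ t → m ≤ w t := by
    intro t ht
    by_contra! hlt
    obtain ⟨s, hs, hsm⟩ := intermediate_value_Icc' ht (hcont.mono Icc_subset_Ici_self)
      ⟨hlt.le, hm1.trans_eq hw0.symm⟩
    have hsmem : w s ∈ Icc m R := ⟨hsm.ge, hup s hs.1⟩
    have h1 := hen' s hs.1 hsmem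
    rw [hsm] at h1
    -- A strict barrier would force `v ^ 2 < 0` at `m`. At a critical barrier of equal energy the
    -- path arrives at rest in an equilibrium and stays there.
    rcases hbar with h | ⟨h, hcrit⟩
    · nlinarith [sq_nonneg (v s)]
    · rw [h, sub_self, mul_zero] at h1
      have h2 := heq s hs.1 hsmem (pow_eq_zero_iff two_ne_zero |>.mp h1)
        (by rw [hsm]; exact forceFn_eq_zero hm h hcrit) t hs.2
      linarith
  refine ⟨w, v, ⟨hw0, fun t ht => hm.trans_le (hlow t ht), hw, fun t ht => ?_⟩, hv0⟩
  have hmem : w t ∈ Icc m R := ⟨hlow t ht, hup t ht⟩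
  have hpos := hm.trans_le hmem.1
  refine (hv t ht hmem).congr_deriv ?_
  rw [forceFn_eq (Γ := Γ) hpos, energyFn_eq hpos, hen' t ht hmem]

/-- An expanding path with exactly the energy of an unstable equilibrium ahead converges to it. -/
theorem exists_isDilation_of_critical {W : ℝ} (hW1 : 1 < W) (hd : 0 < d)
    (hWE : potential k c ρ Γ W = d ^ 2 + potential k c ρ Γ 1)
    (hcrit : k * c * W ^ 2 - k * ρ * W + Γ / 2 = 0)
    (hlt : ∀ x ∈ Ico 1 W, potential k c ρ Γ x < d ^ 2 + potential k c ρ Γ 1) :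
    ∃ w v : ℝ → ℝ, IsDilation k c ρ Γ w v ∧ v 0 = d := by
  set E := d ^ 2 + potential k c ρ Γ 1 with hE
  obtain ⟨w, v, hw0, hv0, hw, hvc, hv, hen, heq⟩ := exists_clamped_newton_solution
    (Φ := energyFn k c ρ Γ E) (a := 1) (b := d) hW1.le (locallyLipschitzOn_forceFn one_pos)
    (fun x hx => hasDerivAt_energyFn (one_pos.trans_le hx.1)) ⟨le_rfl, hW1.le⟩
  have hen' : ∀ t, 0 ≤ t → w t ∈ Icc 1 W → v t ^ 2 = w t * (E - potential k c ρ Γ (w t)) := by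
    intro t ht hwt
    rw [hen t ht hwt, energyFn_eq (one_pos.trans_le hwt.1), energyFn_eq one_pos, hE]
    ring
  have hstay : ∀ s, 0 ≤ s → w s = W → v s = 0 → ∀ t, s ≤ t → w t = W := by
    intro s hs hsW hvs t hst
    rw [← hsW]
    refine heq s hs (by rw [hsW]; exact ⟨hW1.le, le_rfl⟩) hvs ?_ t hst
    rw [hsW]
    exact forceFn_eq_zero (by linarith) hWE hcrit
  have hcont : ContinuousOn w (Ici 0) := fun t ht => (hw t ht).continuousWithinAt
  have hup : ∀ t, 0 ≤ t → w t ≤ W := by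
    intro t ht
    by_contra! hgt
    obtain ⟨s, hs, hsW⟩ := intermediate_value_Icc ht (hcont.mono Icc_subset_Ici_self)
      ⟨hw0.trans_le hW1.le, hgt.le⟩
    have h1 := hen' s hs.1 (by rw [hsW]; exact ⟨hW1.le, le_rfl⟩)
    rw [hsW, hWE, sub_self, mul_zero] at h1
    linarith [hstay s hs.1 hsW (pow_eq_zero_iff two_ne_zero |>.mp h1) t hs.2]
  have hlow : ∀ t, 0 ≤ t → 1 ≤ w t := by
    intro t ht
    by_contra! hlt1
    -- To get below `1` the path must turn back first. At the turning point `s` it lies in `[1, W]`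
    -- with zero speed, and by `hlt` the only such level is `W`, where it stays.
    have ht0 : 0 < t := ht.lt_of_ne (by rintro rfl; linarith)
    obtain ⟨ξ, hξ, hξv⟩ := exists_hasDerivAt_eq_slope w v ht0 (hcont.mono Icc_subset_Ici_self)
      (fun s hs => (hw s hs.1.le).hasDerivAt_of_pos hs.1)
    have hvξ : v ξ < 0 := by
      rw [hξv]
      exact div_neg_of_neg_of_pos (by linarith) (by linarith)
    obtain ⟨s, hs, hvs, hpos⟩ := exists_first_zero (f := fun r => -v r) hξ.1.le
      (hvc.mono Icc_subset_Ici_self).neg (by linarith) (by linarith)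
    have hvs : v s = 0 := neg_eq_zero.mp hvs
    have hws : w 0 ≤ w s := by
      refine monotoneOn_of_deriv_nonneg (convex_Icc 0 s) (hcont.mono Icc_subset_Ici_self)
        (fun r hr => ?_) (fun r hr => ?_) (left_mem_Icc.mpr hs.1.le) (right_mem_Icc.mpr hs.1.le)
        hs.1.le
      all_goals
        rw [interior_Icc] at hr
        have h1 := (hw r hr.1.le).hasDerivAt_of_pos hr.1
      · exact h1.differentiableAt.differentiableWithinAt
      · rw [h1.deriv]; linarith [hpos r ⟨hr.1.le, hr.2⟩]
    rw [hw0] at hws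
    have hwW := hup s hs.1.le
    have h1 := hen' s hs.1.le ⟨hws, hwW⟩
    have h2 : w s = W := by
      by_contra hne
      have h3 := hlt (w s) ⟨hws, hwW.lt_of_ne hne⟩
      rw [hvs] at h1
      nlinarith
    linarith [hstay s hs.1.le h2 hvs t (hs.2.trans hξ.2.le)]
  have hlowpos : ∀ t, 0 ≤ t → 0 < w t := fun t ht => one_pos.trans_le (hlow t ht)
  refine ⟨w, v, ⟨hw0, hlowpos, hw, fun t ht => ?_⟩, hv0⟩
  have hmem : w t ∈ Icc 1 W := ⟨hlow t ht, hup t ht⟩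
  refine (hv t ht hmem).congr_deriv ?_
  rw [forceFn_eq (Γ := Γ) (hlowpos t ht), energyFn_eq (hlowpos t ht), hen' t ht hmem]

end Existence

/-! ### Shape of the potential and the regions `S₁`, `S₂`, `S₃`. -/

section Regions

variable {k c ρ Γ d : ℝ}

theorem potential_lt_potential {x y : ℝ} (hx : 0 < x) (hxy : x < y)
    (h : ∀ z ∈ Ioo x y, 0 < k * c * z ^ 2 - k * ρ * z + Γ / 2) :
    potential k c ρ Γ x < potential k c ρ Γ y := by
  refine strictMonoOn_of_deriv_pos (convex_Icc x y)
    (continuousOn_potential.mono fun z hz => hx.trans_le hz.1) (fun z hz => ?_)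
    (left_mem_Icc.mpr hxy.le) (right_mem_Icc.mpr hxy.le) hxy
  rw [interior_Icc] at hz
  have hz0 := hx.trans hz.1
  rw [(hasDerivAt_potential hz0).deriv]
  have := h z hz
  positivity

theorem potential_gt_potential {x y : ℝ} (hx : 0 < x) (hxy : x < y)
    (h : ∀ z ∈ Ioo x y, k * c * z ^ 2 - k * ρ * z + Γ / 2 < 0) :
    potential k c ρ Γ y < potential k c ρ Γ x := by
  refine strictAntiOn_of_deriv_neg (convex_Icc x y)
    (continuousOn_potential.mono fun z hz => hx.trans_le hz.1) (fun z hz => ?_)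
    (left_mem_Icc.mpr hxy.le) (right_mem_Icc.mpr hxy.le) hxy
  rw [interior_Icc] at hz
  have hz0 := hx.trans hz.1
  rw [(hasDerivAt_potential hz0).deriv]
  have := h z hz
  exact div_neg_of_neg_of_pos (by linarith) (by positivity)

/-- Completing the square in the equation for the equilibria. -/
theorem equilibrium_eq_sq (hc : 0 < c) (x : ℝ) :
    k * c * x ^ 2 - k * ρ * x + Γ / 2
      = k * c * (x - ρ / (2 * c)) ^ 2 + (Γ - k / (2 * c) * ρ ^ 2) / 2 := by
  field_simp
  ring

/-- By the completed square the derivative is positive except possibly at `ρ / (2 c)`; an interval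
containing this point is split there. -/
theorem strictMonoOn_potential (hk : 0 < k) (hc : 0 < c) (hΓ : k / (2 * c) * ρ ^ 2 ≤ Γ) :
    StrictMonoOn (potential k c ρ Γ) (Ioi 0) := by
  have hpos : ∀ z, z ≠ ρ / (2 * c) → 0 < k * c * z ^ 2 - k * ρ * z + Γ / 2 := by
    intro z hz
    rw [equilibrium_eq_sq hc]
    have := pow_pos (abs_pos.mpr (sub_ne_zero.mpr hz)) 2
    rw [sq_abs] at this
    have : 0 < k * c * (z - ρ / (2 * c)) ^ 2 := by positivity
    linarith
  intro x hx y hy hxy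
  have hx : 0 < x := hx
  by_cases hmid : ρ / (2 * c) ∈ Ioo x y
  · exact (potential_lt_potential hx hmid.1 fun z hz => hpos z hz.2.ne).trans
      (potential_lt_potential (hx.trans hmid.1) hmid.2 fun z hz => hpos z hz.1.ne')
  · exact potential_lt_potential hx hxy fun z hz => hpos z (by rintro rfl; exact hmid hz)

/-- The dilation factor at the equilibrium of larger density. -/
noncomputable def lowerRoot (k c ρ Γ : ℝ) : ℝ := (ρ - √(ρ ^ 2 - 2 * c * Γ / k)) / (2 * c)

/-- The dilation factor at the equilibrium of smaller density. -/
noncomputable def upperRoot (k c ρ Γ : ℝ) : ℝ := (ρ + √(ρ ^ 2 - 2 * c * Γ / k)) / (2 * c)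

section TwoEquilibria

theorem discriminant_pos (hk : 0 < k) (hc : 0 < c) (hΓ : Γ < k / (2 * c) * ρ ^ 2) :
    0 < ρ ^ 2 - 2 * c * Γ / k := by
  have h : 2 * c * Γ / k < 2 * c * (k / (2 * c) * ρ ^ 2) / k := by gcongr
  have h' : 2 * c * (k / (2 * c) * ρ ^ 2) / k = ρ ^ 2 := by field_simp
  linarith

theorem equilibrium_eq_mul (hk : 0 < k) (hc : 0 < c) (hΓ : Γ < k / (2 * c) * ρ ^ 2) (x : ℝ) :
    k * c * x ^ 2 - k * ρ * x + Γ / 2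
      = k * c * (x - lowerRoot k c ρ Γ) * (x - upperRoot k c ρ Γ) := by
  have h := Real.sq_sqrt (discriminant_pos hk hc hΓ).le
  have h' : Γ = k * (ρ ^ 2 - √(ρ ^ 2 - 2 * c * Γ / k) ^ 2) / (2 * c) := by
    rw [h]; field_simp; ring
  unfold lowerRoot upperRoot
  generalize √(ρ ^ 2 - 2 * c * Γ / k) = s at h'
  rw [h']
  field_simp
  ring

theorem lowerRoot_lt_upperRoot (hk : 0 < k) (hc : 0 < c) (hΓ : Γ < k / (2 * c) * ρ ^ 2) :
    lowerRoot k c ρ Γ < upperRoot k c ρ Γ := by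
  have h := Real.sqrt_pos.mpr (discriminant_pos hk hc hΓ)
  unfold lowerRoot upperRoot
  gcongr
  linarith

theorem lowerRoot_pos (hk : 0 < k) (hc : 0 < c) (hρ : 0 < ρ) (hΓ0 : 0 < Γ) :
    0 < lowerRoot k c ρ Γ := by
  have : √(ρ ^ 2 - 2 * c * Γ / k) < ρ := by
    rw [Real.sqrt_lt' hρ]
    have : 0 < 2 * c * Γ / k := by positivity
    linarith
  unfold lowerRoot
  exact div_pos (by linarith) (by linarith)

theorem lowerRoot_mul_upperRoot (hk : 0 < k) (hc : 0 < c) (hΓ : Γ < k / (2 * c) * ρ ^ 2) :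
    lowerRoot k c ρ Γ * upperRoot k c ρ Γ = Γ / (2 * k * c) := by
  have h := equilibrium_eq_mul hk hc hΓ 0
  have hkc : 0 < k * c := mul_pos hk hc
  field_simp
  linarith

/-- The radicand is the height of the hill at `lowerRoot` above the starting level. By Vieta `Γ /
lowerRoot = 2 k c * upperRoot`, and the difference of the roots gives the square root in `g₁`. -/
theorem g₁Radicand_eq (hk : 0 < k) (hc : 0 < c) (hρ : 0 < ρ) (hΓ0 : 0 < Γ)
    (hΓ : Γ < k / (2 * c) * ρ ^ 2) :
    g₁Radicand k c ρ Γ = potential k c ρ Γ (lowerRoot k c ρ Γ) - potential k c ρ Γ 1 := by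
  have hpos := lowerRoot_pos hk hc hρ hΓ0
  have h1 : Γ / lowerRoot k c ρ Γ = 2 * k * c * upperRoot k c ρ Γ := by
    rw [div_eq_iff hpos.ne', mul_assoc, mul_comm (upperRoot k c ρ Γ),
      lowerRoot_mul_upperRoot hk hc hΓ]
    field_simp
  have h2 : 2 * k * c * (upperRoot k c ρ Γ - lowerRoot k c ρ Γ)
      = 2 * k * √(ρ ^ 2 - 2 * c * Γ / k) := by
    unfold upperRoot lowerRoot
    field_simp
    ring
  unfold g₁Radicand
  change Γ - 2 * k * (c + √(ρ ^ 2 - 2 * c * Γ / k) + ρ * Real.log (lowerRoot k c ρ Γ)) = _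
  simp only [potential, neg_div, h1, Real.log_one, div_one]
  linarith

theorem rhoStar_eq (hk : 0 < k) (hc : 0 < c) (hρ : 0 < ρ) (hΓ0 : 0 < Γ)
    (hΓ : Γ < k / (2 * c) * ρ ^ 2) : rhoStar k c ρ Γ = ρ / lowerRoot k c ρ Γ := by
  have hpos := lowerRoot_pos hk hc hρ hΓ0
  have h1 : √(k ^ 2 - 2 * c * k * (Γ / ρ ^ 2)) = k / ρ * √(ρ ^ 2 - 2 * c * Γ / k) := by
    have : k ^ 2 - 2 * c * k * (Γ / ρ ^ 2) = (k / ρ) ^ 2 * (ρ ^ 2 - 2 * c * Γ / k) := by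
      field_simp
    rw [this, Real.sqrt_mul (by positivity), Real.sqrt_sq (by positivity)]
  have h2 : k + k / ρ * √(ρ ^ 2 - 2 * c * Γ / k) = 2 * k * c * upperRoot k c ρ Γ / ρ := by
    unfold upperRoot
    field_simp
  have h3 : 2 * k * c * (lowerRoot k c ρ Γ * upperRoot k c ρ Γ) = Γ := by
    rw [lowerRoot_mul_upperRoot hk hc hΓ]; field_simp
  rw [rhoStar, h1, h2, div_div_eq_mul_div, div_eq_div_iff hΓ0.ne' hpos.ne']
  field_simp
  linarith

/-- `ρ*` is the density `ρ / w` at `w = lowerRoot`, so the comparison with `ρ` tells on which side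
of the hill the start `w = 1` lies. -/
theorem le_rhoStar_iff (hk : 0 < k) (hc : 0 < c) (hρ : 0 < ρ) (hΓ0 : 0 < Γ)
    (hΓ : Γ < k / (2 * c) * ρ ^ 2) : ρ ≤ rhoStar k c ρ Γ ↔ lowerRoot k c ρ Γ ≤ 1 := by
  rw [rhoStar_eq hk hc hρ hΓ0 hΓ, le_div_iff₀ (lowerRoot_pos hk hc hρ hΓ0)]
  constructor
  · intro h
    exact le_of_mul_le_mul_left (by linarith) hρ
  · intro h
    nlinarith

theorem potential_lt_of_le_lowerRoot (hk : 0 < k) (hc : 0 < c) (hΓ : Γ < k / (2 * c) * ρ ^ 2)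
    {x y : ℝ} (hx : 0 < x) (hxy : x < y) (hy : y ≤ lowerRoot k c ρ Γ) :
    potential k c ρ Γ x < potential k c ρ Γ y := by
  refine potential_lt_potential hx hxy fun z hz => ?_
  rw [equilibrium_eq_mul hk hc hΓ]
  have h1 := lowerRoot_lt_upperRoot hk hc hΓ
  have h2 : z - lowerRoot k c ρ Γ < 0 := by linarith [hz.2]
  have h3 : z - upperRoot k c ρ Γ < 0 := by linarith
  have := mul_pos_of_neg_of_neg h2 h3
  rw [mul_assoc]
  positivity

theorem potential_lt_of_upperRoot_le (hk : 0 < k) (hc : 0 < c) (hΓ : Γ < k / (2 * c) * ρ ^ 2)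
    {x y : ℝ} (hx0 : 0 < x) (hx : upperRoot k c ρ Γ ≤ x) (hxy : x < y) :
    potential k c ρ Γ x < potential k c ρ Γ y := by
  refine potential_lt_potential hx0 hxy fun z hz => ?_
  rw [equilibrium_eq_mul hk hc hΓ]
  have h1 := lowerRoot_lt_upperRoot hk hc hΓ
  have h2 : 0 < z - upperRoot k c ρ Γ := by linarith [hz.1]
  have h3 : 0 < z - lowerRoot k c ρ Γ := by linarith
  positivity

theorem potential_lt_of_between (hk : 0 < k) (hc : 0 < c) (hΓ : Γ < k / (2 * c) * ρ ^ 2)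
    {x y : ℝ} (hx0 : 0 < x) (hx : lowerRoot k c ρ Γ ≤ x) (hxy : x < y)
    (hy : y ≤ upperRoot k c ρ Γ) : potential k c ρ Γ y < potential k c ρ Γ x := by
  refine potential_gt_potential hx0 hxy fun z hz => ?_
  rw [equilibrium_eq_mul hk hc hΓ]
  have h2 : z - upperRoot k c ρ Γ < 0 := by linarith [hz.2]
  have h3 : 0 < z - lowerRoot k c ρ Γ := by linarith [hz.1]
  exact mul_neg_of_pos_of_neg (by positivity) h2

end TwoEquilibria

theorem g₂Radicand_eq (hc : 0 < c) (hΓ : Γ = k / (2 * c) * ρ ^ 2) :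
    g₂Radicand k c ρ = potential k c ρ Γ (ρ / (2 * c)) - potential k c ρ Γ 1 := by
  have h : Real.log (2 * c / ρ) = -Real.log (ρ / (2 * c)) := by
    rw [← Real.log_inv, inv_div]
  simp only [g₂Radicand, potential, h, Real.log_one]
  rw [hΓ]
  field_simp
  ring

/-- Outside `S₁`, either a barrier lies below the start, and then the hill is at or below `1` and at
least as high as the energy, or `exists_critical_level` gives a critical level of exactly the energy
`E`, which fixes `d`. -/
theorem mem_region_of_isDilation (hk : 0 < k) (hc : 0 < c) (hρ : 0 ≤ ρ) {w v : ℝ → ℝ}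
    (h : IsDilation k c ρ Γ w v) :
    (ρ, v 0, Γ) ∈ regionS₁ ∪ regionS₂ k c ∪ regionS₃ k c := by
  by_cases h1 : Γ ≤ 0 ∧ (ρ = 0 → Γ < 0)
  · exact Or.inl (Or.inl h1)
  have hΓρ : 0 < Γ ∨ Γ = 0 ∧ ρ = 0 := by
    rcases lt_or_ge 0 Γ with h0 | h0
    · exact Or.inl h0
    · have h2 : ¬ (ρ = 0 → Γ < 0) := fun h' => h1 ⟨h0, h'⟩
      push Not at h2
      exact Or.inr ⟨le_antisymm h0 h2.2, h2.1⟩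
  have hsq := sq_nonneg (v 0)
  rcases lt_or_ge Γ (k / (2 * c) * ρ ^ 2) with hlt | hge
  · -- two distinct equilibria
    have hΓ0 : 0 < Γ := by
      rcases hΓρ with h0 | ⟨h0, rfl⟩
      · exact h0
      · simp [h0] at hlt
    have hρ0 : 0 < ρ := by
      refine hρ.lt_of_ne ?_
      rintro rfl
      simp at hlt
      linarith
    have hl0 := lowerRoot_pos hk hc hρ0 hΓ0
    have hlu := lowerRoot_lt_upperRoot hk hc hlt
    have hrad := g₁Radicand_eq hk hc hρ0 hΓ0 hlt
    refine Or.inl (Or.inr ⟨hΓ0, hlt, ?_⟩)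
    rw [le_rhoStar_iff hk hc hρ0 hΓ0 hlt, ← not_le, le_rhoStar_iff hk hc hρ0 hΓ0 hlt]
    by_cases hK : ∀ x ∈ Ioo 0 1, potential k c ρ Γ x < v 0 ^ 2 + potential k c ρ Γ 1
    · obtain ⟨hv, W, hW1, hWE, hWc, hWle⟩ := h.exists_critical_level hk hc hρ hΓρ hK
      have hW : W = lowerRoot k c ρ Γ := by
        rw [equilibrium_eq_mul hk hc hlt, mul_eq_zero, mul_eq_zero] at hWc
        rcases hWc with (h0 | h0) | h0
        · exact absurd h0 (by positivity)
        · linarith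
        -- `W` cannot be the valley: the hill lies below it on the axis and is higher, contrary to
        -- `hWle`.
        · exfalso
          have h2 := potential_lt_of_between hk hc hlt hl0 le_rfl hlu le_rfl
          have hW : W = upperRoot k c ρ Γ := by linarith
          subst hW
          linarith [hWle _ ⟨hl0, hlu⟩]
      rw [← hW] at hrad ⊢
      have hrad' : g₁Radicand k c ρ Γ = v 0 ^ 2 := by rw [hrad, hWE]; ring
      have hg : v 0 = g₁ k c ρ Γ := by rw [g₁, hrad', Real.sqrt_sq hv]
      refine ⟨by rw [hrad']; exact hsq, fun _ => ?_, fun _ => hg⟩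
      rw [← hg, abs_of_nonneg hv]
    · push Not at hK
      obtain ⟨x, ⟨hx0, hx1⟩, hxE⟩ := hK
      have hl1 : lowerRoot k c ρ Γ ≤ 1 := by
        by_contra! hl
        linarith [potential_lt_of_le_lowerRoot hk hc hlt hx0 hx1 hl.le]
      have hlx : potential k c ρ Γ x ≤ potential k c ρ Γ (lowerRoot k c ρ Γ) := by
        rcases lt_trichotomy x (lowerRoot k c ρ Γ) with h2 | h2 | h2
        · exact (potential_lt_of_le_lowerRoot hk hc hlt hx0 h2 le_rfl).le
        · rw [h2]
        · rcases le_or_gt x (upperRoot k c ρ Γ) with h3 | h3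
          · exact (potential_lt_of_between hk hc hlt hl0 le_rfl h2 h3).le
          · linarith [potential_lt_of_upperRoot_le hk hc hlt hx0 h3.le hx1]
      have hv : v 0 ^ 2 ≤ g₁Radicand k c ρ Γ := by rw [hrad]; linarith
      exact ⟨hsq.trans hv, fun _ => Real.abs_le_sqrt hv, fun h2 => absurd hl1 h2⟩
  -- A strictly increasing potential offers no barrier below `1`, so a critical level must exist;
  -- the completed square then forces equality in `hge`.
  · -- at most one equilibrium
    have hmono := strictMonoOn_potential hk hc hge
    obtain ⟨hv, W, hW1, hWE, hWc, -⟩ := h.exists_critical_level hk hc hρ hΓρ (fun x hx => by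
      have := hmono hx.1 (mem_Ioi.mpr one_pos) hx.2
      linarith)
    rw [equilibrium_eq_sq hc] at hWc
    have h2 : 0 ≤ k * c * (W - ρ / (2 * c)) ^ 2 := by positivity
    have hΓeq : Γ = k / (2 * c) * ρ ^ 2 := by linarith
    have h3 : k * c * (W - ρ / (2 * c)) ^ 2 = 0 := by linarith
    have hW : W = ρ / (2 * c) := by
      have := (mul_eq_zero.mp h3).resolve_left (by positivity)
      linarith [pow_eq_zero_iff two_ne_zero |>.mp this]
    have hρ0 : 0 < ρ := by
      refine hρ.lt_of_ne ?_
      rintro rfl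
      rw [hW] at hW1
      norm_num at hW1
    have hrad := g₂Radicand_eq hc hΓeq
    rw [← hW, hWE] at hrad
    have hrad' : g₂Radicand k c ρ = v 0 ^ 2 := by linarith
    exact Or.inr ⟨hρ0, hΓeq, by rw [hrad']; exact hsq, by rw [g₂, hrad', Real.sqrt_sq hv]⟩

/-- The singular part of the potential provides a barrier near zero in the first region. -/
theorem exists_potential_gt_near_zero (hk : 0 < k) (hc : 0 < c) (hρ : 0 ≤ ρ) (hΓ : Γ ≤ 0)
    (hΓρ : ρ = 0 → Γ < 0) (C : ℝ) : ∃ m, 0 < m ∧ m ≤ 1 ∧ C < potential k c ρ Γ m := by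
  rcases hΓ.lt_or_eq with hneg | rfl
  · have hpos : 0 < |C| + 1 := by positivity
    refine ⟨min 1 (-Γ / (|C| + 1)), lt_min one_pos (div_pos (by linarith) hpos),
      min_le_left _ _, ?_⟩
    set m := min 1 (-Γ / (|C| + 1))
    have hm0 : 0 < m := lt_min one_pos (div_pos (by linarith) hpos)
    have h1 : |C| + 1 ≤ -Γ / m := by
      rw [le_div_iff₀ hm0, mul_comm, ← le_div_iff₀ hpos]
      exact min_le_right _ _
    have h2 : 2 * k * ρ * Real.log m ≤ 0 :=
      mul_nonpos_of_nonneg_of_nonpos (by positivity)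
        (Real.log_nonpos hm0.le (min_le_left _ _))
    have h3 : 0 < 2 * k * c * m := by positivity
    have h4 := le_abs_self C
    unfold potential
    linarith
  · have hρ0 : 0 < ρ := hρ.lt_of_ne (by rintro rfl; exact lt_irrefl _ (hΓρ rfl))
    have hkρ : 0 < 2 * k * ρ := by positivity
    refine ⟨Real.exp (-(|C| / (2 * k * ρ))), Real.exp_pos _,
      Real.exp_le_one_iff.mpr (neg_nonpos.mpr (by positivity)), ?_⟩
    have h3 : 0 < 2 * k * c * Real.exp (-(|C| / (2 * k * ρ))) := by positivity
    have h4 := le_abs_self C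
    have h5 : 2 * k * ρ * (|C| / (2 * k * ρ)) = |C| := mul_div_cancel₀ _ hkρ.ne'
    simp only [potential, Real.log_exp, neg_zero, zero_div]
    linarith

theorem exists_isDilation_of_mem_region (hk : 0 < k) (hc : 0 < c) (hρ : 0 ≤ ρ)
    (h : (ρ, d, Γ) ∈ regionS₁ ∪ regionS₂ k c ∪ regionS₃ k c) :
    ∃ w v : ℝ → ℝ, IsDilation k c ρ Γ w v ∧ v 0 = d := by
  rcases h with (⟨hΓ, hΓρ⟩ | ⟨hΓ0, hlt, hr0, hle, hgt⟩) | ⟨hρ0, hΓ, hr0, hd⟩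
  · obtain ⟨m, hm0, hm1, hm⟩ := exists_potential_gt_near_zero hk hc hρ hΓ hΓρ
      (d ^ 2 + potential k c ρ Γ 1)
    obtain ⟨R, hR1, hR⟩ := exists_potential_gt (Γ := Γ) hk hc hρ (d ^ 2 + potential k c ρ Γ 1)
    exact exists_isDilation_of_barrier hm0 hm1 hR1 (hR R le_rfl) (Or.inl hm)
  · have hρ0 : 0 < ρ := by
      refine hρ.lt_of_ne ?_
      rintro rfl
      simp at hlt
      linarith
    have hl0 := lowerRoot_pos hk hc hρ0 hΓ0
    have hrad := g₁Radicand_eq hk hc hρ0 hΓ0 hlt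
    have hcrit : k * c * lowerRoot k c ρ Γ ^ 2 - k * ρ * lowerRoot k c ρ Γ + Γ / 2 = 0 := by
      rw [equilibrium_eq_mul hk hc hlt]; ring
    rw [le_rhoStar_iff hk hc hρ0 hΓ0 hlt] at hle
    rw [← not_le, le_rhoStar_iff hk hc hρ0 hΓ0 hlt, not_le] at hgt
    -- With the hill at or to the left of `1` it serves as the barrier; otherwise the path climbs
    -- towards it from the left with exactly its energy.
    rcases le_or_gt (lowerRoot k c ρ Γ) 1 with hl1 | hl1
    · obtain ⟨R, hR1, hR⟩ := exists_potential_gt (Γ := Γ) hk hc hρ (d ^ 2 + potential k c ρ Γ 1)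
      have h1 : d ^ 2 ≤ g₁Radicand k c ρ Γ := by
        rw [← sq_abs]
        exact (Real.le_sqrt (abs_nonneg d) hr0).mp (hle hl1)
      refine exists_isDilation_of_barrier hl0 hl1 hR1 (hR R le_rfl) ?_
      rcases h1.lt_or_eq with h2 | h2
      · left; linarith
      · right; exact ⟨by linarith, hcrit⟩
    · have hd := hgt hl1
      have hd2 : d ^ 2 = g₁Radicand k c ρ Γ := by rw [hd, g₁, Real.sq_sqrt hr0]
      have h1 := potential_lt_of_le_lowerRoot hk hc hlt one_pos hl1 le_rfl
      have hd0 : 0 < d := by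
        rw [hd, g₁, Real.sqrt_pos, hrad]; linarith
      refine exists_isDilation_of_critical hl1 hd0 (by linarith) hcrit fun x hx => ?_
      have := potential_lt_of_le_lowerRoot hk hc hlt (one_pos.trans_le hx.1) hx.2 le_rfl
      linarith
  · have hrad := g₂Radicand_eq hc hΓ
    have hmono := strictMonoOn_potential hk hc hΓ.ge
    have hW0 : 0 < ρ / (2 * c) := by positivity
    have hcrit : k * c * (ρ / (2 * c)) ^ 2 - k * ρ * (ρ / (2 * c)) + Γ / 2 = 0 := by
      rw [equilibrium_eq_sq hc, hΓ]; ring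
    have hd2 : d ^ 2 = g₂Radicand k c ρ := by rw [hd, g₂, Real.sq_sqrt hr0]
    have hW1 : 1 ≤ ρ / (2 * c) := by
      rw [← hmono.le_iff_le (mem_Ioi.mpr one_pos) hW0]
      linarith
    rcases hW1.eq_or_lt with h1 | h1
    · obtain ⟨R, hR1, hR⟩ := exists_potential_gt (Γ := Γ) hk hc hρ (d ^ 2 + potential k c ρ Γ 1)
      exact exists_isDilation_of_barrier hW0 h1.ge hR1 (hR R le_rfl)
        (Or.inr ⟨by linarith, hcrit⟩)
    · have h2 := hmono (mem_Ioi.mpr one_pos) hW0 h1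
      have hd0 : 0 < d := by
        rw [hd, g₂, Real.sqrt_pos, hrad]; linarith
      refine exists_isDilation_of_critical h1 hd0 (by linarith) hcrit fun x hx => ?_
      have := hmono (mem_Ioi.mpr (one_pos.trans_le hx.1)) hW0 hx.2
      linarith

theorem hasGlobalPath_iff_mem_region (hk : 0 < k) (hc : 0 < c) {A : Mat2} {r : ℝ} (hr : 0 ≤ r) :
    HasGlobalPath k c A r ↔
      (r, divergence A, gapSq A) ∈ regionS₁ ∪ regionS₂ k c ∪ regionS₃ k c := by
  rw [hasGlobalPath_iff]
  constructor
  · rintro ⟨w, v, h, hv⟩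
    rw [← hv]
    exact mem_region_of_isDilation hk hc hr h
  · exact exists_isDilation_of_mem_region hk hc hr

end Regions

theorem theorem1p2 (k c : ℝ) (hk : 0 < k) (hc : 0 < c)
    (M₀ : Plane → Mat2) (ρ₀ : Plane → ℝ)
    (hM₀ : ∀ i j : Fin 2, ContDiff ℝ ∞ (fun α => M₀ α i j))
    (hρ₀ : ContDiff ℝ ∞ ρ₀) (hρ₀_nonneg : ∀ α, 0 ≤ ρ₀ α) :
    (RemainsSmooth k c M₀ ρ₀ ↔
      ∀ α, (ρ₀ α, divergence (M₀ α), gapSq (M₀ α)) ∈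
        regionS₁ ∪ regionS₂ k c ∪ regionS₃ k c) ∧
    (∀ α, k / (2 * c) * ρ₀ α ^ 2 < gapSq (M₀ α) → BreaksDown k c (M₀ α) (ρ₀ α)) := by
  constructor
  · rw [remainsSmooth_iff hM₀ hρ₀]
    exact forall_congr' fun α => hasGlobalPath_iff_mem_region hk hc (hρ₀_nonneg α)
  · intro α hα
    refine breaksDown_of_not_hasGlobalPath ?_
    rw [hasGlobalPath_iff_mem_region hk hc (hρ₀_nonneg α)]
    have h0 : 0 ≤ k / (2 * c) * ρ₀ α ^ 2 := by positivity
    rintro ((⟨h, -⟩ | ⟨-, h, -⟩) | ⟨-, h, -⟩) <;> linarith
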